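/- **Local semicircle law.** Let $n\ge 1$, $\sigma>0$. An $n\times n$ *Wigner matrix* with diagonal variance $\sigma^2$ is a random Hermitian matrix $M_n=(\xi_{ij})_{1\le i,j\le n}$ such that the entries $\xi_{ij}$, $1\le i\le j\le n$, are jointly independent with mean zero, $\mathbf E|\xi_{ij}|^2=1$ for $i<j$, $\mathbf E|\xi_{ii}|^2=\sigma^2$, and $\Re\xi_{ij}$, $\Im\xi_{ij}$ are independent for each $i<j$. It obeys Condition C1 with constants $C,C'>0$ if $$\mathbf P(|\xi_{ij}|\ge t^{C})\le e^{-t}\qquad\text{for all } 1\le i,j\le n \text{ and all } t\ge C'.$$ Write $W_n:=\frac1{\sqrt n}M_n$, $R(z):=(W_n-z)^{-1}$, $s_{W_n}(z):=\frac1n\operatorname{tr}R(z)$ and $$s_{sc}(z):=\int_{\mathbb R}\frac{1}{x-z}\,\rho_{sc}(x)\,dx,\qquad \rho_{sc}(x):=\frac1{2\pi}\,(4-x^2)_+^{1/2}.$$ For all $C,C'>0$ there is a constant $c>0$, depending only on $C,C'$, with the following property. For all real $K_1,K_2$ there are a real $A$, a natural number $B$ and a sequence $\varepsilon_n\to0$,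 depending only on $C,C',K_1,K_2$, such that for every $n\ge1$, every $\sigma>0$, every $n\times n$ Wigner matrix $M_n$ with diagonal variance $\sigma^2$ obeying Condition C1 with constants $C,C'$, and every $z=E+\sqrt{-1}\,\eta$ with $|E|\le K_1$ and $0<\eta\le K_2n^{100}$, one has $$|s_{W_n}(z)-s_{sc}(z)|\le\varepsilon_n\qquad\text{and}\qquad |R(z)_{ii}-s_{sc}(z)|\le\varepsilon_n\quad\text{for all }1\le i\le n$$ outside an event of probability at most $A\,n^{B}\exp(-c\,(n\eta)^{c})$. -/

import Mathlib

open MeasureTheory ProbabilityTheory Filter Topology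

noncomputable section

/-- `M` is an `n × n` Wigner matrix on the probability space `(Ω, P)` with diagonal variance `σ ^ 2`:
a random Hermitian matrix whose entries on and above the diagonal are jointly independent and
centred, with variance `1` off the diagonal and `σ ^ 2` on it, and whose entries above the diagonal
have independent real and imaginary parts. As the entries have mean zero, the variance of an entry
is the expectation of the square of its absolute value. -/
structure IsWignerMatrix {Ω : Type*} [MeasurableSpace Ω] (P : Measure Ω) {n : ℕ} (σ : ℝ)
    (M : Ω → Matrix (Fin n) (Fin n) ℂ) : Prop where
  sigma_pos : 0 < σ
  measurable_entry : ∀ i j, Measurable fun ω => M ω i j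
  isHermitian : ∀ ω, (M ω).IsHermitian
  indep : iIndepFun
    (fun (p : {p : Fin n × Fin n // p.1 ≤ p.2}) (ω : Ω) => M ω p.1.1 p.1.2) P
  memLp_two : ∀ i j, MemLp (fun ω => M ω i j) 2 P
  mean_zero : ∀ i j, ∫ ω, M ω i j ∂P = 0
  variance_offDiag : ∀ i j, i < j → ∫ ω, ‖M ω i j‖ ^ 2 ∂P = 1
  variance_diag : ∀ i, ∫ ω, ‖M ω i i‖ ^ 2 ∂P = σ ^ 2
  indep_re_im : ∀ i j, i < j → IndepFun (fun ω => (M ω i j).re) (fun ω => (M ω i j).im) P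

/-- The exponential decay condition on the entries, with constants `C` and `C'`. -/
def HasExpDecay {Ω : Type*} [MeasurableSpace Ω] (P : Measure Ω) {n : ℕ} (C C' : ℝ)
    (M : Ω → Matrix (Fin n) (Fin n) ℂ) : Prop :=
  ∀ i j, ∀ t : ℝ, C' ≤ t → P.real {ω | t ^ C ≤ ‖M ω i j‖} ≤ Real.exp (-t)

/-- The normalisation `n ^ (-1/2) M` of an `n × n` matrix `M`. -/
def normalized {n : ℕ} (M : Matrix (Fin n) (Fin n) ℂ) : Matrix (Fin n) (Fin n) ℂ :=
  ((1 / Real.sqrt n : ℝ) : ℂ) • M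

/-- The resolvent `(W - z)⁻¹`; for `W` Hermitian and `0 < z.im` the matrix `W - z` is invertible. -/
def matrixResolvent {n : ℕ} (W : Matrix (Fin n) (Fin n) ℂ) (z : ℂ) : Matrix (Fin n) (Fin n) ℂ :=
  (W - z • (1 : Matrix (Fin n) (Fin n) ℂ))⁻¹

/-- The Stieltjes transform `(1 / n) tr (W - z)⁻¹` of the spectrum of `W`. -/
def stieltjes {n : ℕ} (W : Matrix (Fin n) (Fin n) ℂ) (z : ℂ) : ℂ :=
  (1 / (n : ℂ)) * (matrixResolvent W z).trace

/-- The semicircular density `(1 / 2π) (4 - x ^ 2)₊ ^ (1/2)`. -/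
def rhoSC (x : ℝ) : ℝ := 1 / (2 * Real.pi) * Real.sqrt (max (4 - x ^ 2) 0)

/-- The Stieltjes transform of the semicircular distribution. -/
def stieltjesSC (z : ℂ) : ℂ := ∫ x : ℝ, 1 / ((x : ℂ) - z) * (rhoSC x : ℂ)

end

/-! The Stieltjes transform `m` of the semicircle law is the root of `m² + z m + 1 = 0` inside the
unit disc. The diagonal entries of the resolvent satisfy a random perturbation of this equation. By
the Schur complement formula (`schur_diag`), `1 / R_ii = W_ii - z - Q_i`, where `Q_i` is a quadratic
form in the `i`-th column with coefficients from the resolvent of the `i`-th minor. The column is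
independent of the minor, so `Q_i` concentrates around the normalised trace of the minor's
resolvent. This trace differs from `s` by at most `1/(nη)`. The fluctuation is governed by the
Frobenius norm of that resolvent, which the Ward identity bounds by a multiple of `n / √(nη)` as
long as `Im s` is bounded.

Averaging over `i` gives `(s - m)(s - 1/m) = O(δ)`, so `s` is near one of the two roots
(`norm_sub_mul_norm_sub_inv_le`). A continuity argument along a vertical segment selects the right
root (`local_law_of_isConcentratedAt`). At height at least `4` only `m` is possible. On the way down
through a grid of mesh `4/n⁴`, `s` cannot jump to `1/m` while the roots are well separated; and
since `|m - 1/m|` decreases with the height, roots that have come close stay close, and then either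
one will do.

The probabilistic input is a moment inequality for quadratic forms with explicit dependence on the
order `p` (`sqMoment_add_mul_le`, `measure_quadratic_form_le`). Adding an independent centred term
increases the square of the `L^(2p)` norm additively, up to a factor of order `p μ²`. Condition C1
gives `μ` of order `p^D`, so Markov's inequality yields failure probability `exp(-2p)` at a
tolerance polynomial in `p`. Taking `p` to be a small power of `nη` keeps the tolerance below
`(nη)^(1/8)` up to a constant, which the gain `(nη)^(-1/2)` absorbs. When `(nη)^c < log n` the
claimed probability bound exceeds one, so a tolerance depending on `n` alone suffices. -/

/-! ### The Stieltjes transform of the semicircle law. -/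

/-- Every point of the upper half-plane is `w + w⁻¹` for some `w` in the punctured unit disc. -/
theorem exists_joukowski_of_im_pos {z : ℂ} (hz : 0 < z.im) :
    ∃ w : ℂ, w ≠ 0 ∧ ‖w‖ < 1 ∧ z = w + w⁻¹ := by
  obtain ⟨s, hs⟩ := IsAlgClosed.exists_pow_nat_eq (z ^ 2 - 4) (n := 2) (by norm_num)
  have h12 : ((z + s) / 2) * ((z - s) / 2) = 1 := by linear_combination (-1 / 4) * hs
  -- The roots `(z ± s)/2` of `w² - z w + 1` are mutually inverse. Neither is on the unit circle,
  -- where `w + w⁻¹ = w + conj w` would be real.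
  have key : ∀ w v : ℂ, w * v = 1 → w + v = z → w ≠ 0 ∧ ‖w‖ ≠ 1 ∧ z = w + w⁻¹ := by
    intro w v hwv hz'
    have hw : w ≠ 0 := left_ne_zero_of_mul_eq_one hwv
    have hv : v = w⁻¹ := eq_inv_of_mul_eq_one_right hwv
    refine ⟨hw, fun h1 => ?_, by rw [← hv, hz']⟩
    rw [hv, Complex.inv_eq_conj h1] at hz'
    rw [← hz'] at hz
    simp at hz
  obtain ⟨hw, hw1, hwz⟩ := key _ _ h12 (by ring)
  obtain ⟨hv, hv1, hvz⟩ := key _ _ (by rw [mul_comm]; exact h12) (by ring)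
  rcases lt_or_gt_of_ne hw1 with h | h
  · exact ⟨_, hw, h, hwz⟩
  · refine ⟨_, hv, ?_, hvz⟩
    have : ‖(z + s) / 2‖ * ‖(z - s) / 2‖ = 1 := by rw [← norm_mul, h12, norm_one]
    by_contra hcon
    push Not at hcon
    nlinarith

theorem integral_cos_nat_mul {k : ℕ} (hk : k ≠ 0) :
    ∫ θ in (0 : ℝ)..Real.pi, Real.cos (k * θ) = 0 := by
  rw [intervalIntegral.integral_comp_mul_left (fun x => Real.cos x) (by exact_mod_cast hk)]
  simp [Real.sin_nat_mul_pi]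

theorem integral_sin_mul_sin_nat (k : ℕ) :
    ∫ θ in (0 : ℝ)..Real.pi, Real.sin θ * Real.sin ((k + 1 : ℕ) * θ)
      = if k = 0 then Real.pi / 2 else 0 := by
  have h : ∀ θ : ℝ, Real.sin θ * Real.sin ((k + 1 : ℕ) * θ)
      = 1 / 2 * (Real.cos ((k : ℕ) * θ) - Real.cos ((k + 2 : ℕ) * θ)) := by
    intro θ
    have h1 : ((k : ℕ) : ℝ) * θ = (k + 1 : ℕ) * θ - θ := by push_cast; ring
    have h2 : ((k + 2 : ℕ) : ℝ) * θ = (k + 1 : ℕ) * θ + θ := by push_cast; ring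
    rw [h1, h2, Real.cos_sub, Real.cos_add]; ring
  simp_rw [h]
  rw [intervalIntegral.integral_const_mul, intervalIntegral.integral_sub
    (Continuous.intervalIntegrable (by fun_prop) _ _)
    (Continuous.intervalIntegrable (by fun_prop) _ _), integral_cos_nat_mul (k := k + 2) (by omega)]
  split_ifs with hk
  · subst hk; simp; ring
  · rw [integral_cos_nat_mul hk]; ring

theorem one_sub_mul_exp_ne_zero {u : ℂ} (hu : ‖u‖ < 1) (θ : ℝ) :
    1 - u * Complex.exp (θ * Complex.I) ≠ 0 := by
  intro h
  have h1 : ‖u * Complex.exp (θ * Complex.I)‖ = 1 := by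
    rw [← sub_eq_zero.mp h, norm_one]
  rw [norm_mul, Complex.norm_exp_ofReal_mul_I, mul_one] at h1
  exact hu.ne h1

/-- This is the generating function of the Chebyshev polynomials of the second kind, multiplied by
`sin θ`: writing the sine by exponentials splits it into two geometric series. -/
theorem hasSum_pow_mul_sin {u : ℂ} (hu : ‖u‖ < 1) (θ : ℝ) :
    HasSum (fun k : ℕ => u ^ k * (Real.sin ((k + 1 : ℕ) * θ) : ℂ))
      ((Real.sin θ : ℂ) / ((1 - u * Complex.exp (θ * Complex.I))
        * (1 - u * Complex.exp (-θ * Complex.I)))) := by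
  have ha := one_sub_mul_exp_ne_zero hu θ
  have hb := one_sub_mul_exp_ne_zero hu (-θ)
  push_cast at hb
  have hna : ‖u * Complex.exp (θ * Complex.I)‖ < 1 := by
    rwa [norm_mul, Complex.norm_exp_ofReal_mul_I, mul_one]
  have hnb : ‖u * Complex.exp (-θ * Complex.I)‖ < 1 := by
    have := Complex.norm_exp_ofReal_mul_I (-θ)
    push_cast at this
    rwa [norm_mul, this, mul_one]
  have h := (((hasSum_geometric_of_norm_lt_one hnb).mul_left
    (Complex.exp (-θ * Complex.I))).sub
    ((hasSum_geometric_of_norm_lt_one hna).mul_left (Complex.exp (θ * Complex.I)))).mul_left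
    (Complex.I / 2)
  have hterm : ∀ k : ℕ, u ^ k * (Real.sin ((k + 1 : ℕ) * θ) : ℂ) = Complex.I / 2 *
      (Complex.exp (-θ * Complex.I) * (u * Complex.exp (-θ * Complex.I)) ^ k -
        Complex.exp (θ * Complex.I) * (u * Complex.exp (θ * Complex.I)) ^ k) := by
    intro k
    rw [Complex.ofReal_sin, Complex.sin, mul_pow, mul_pow, ← Complex.exp_nat_mul,
      ← Complex.exp_nat_mul]
    have e1 : Complex.exp (-(((k + 1 : ℕ) * θ : ℝ) : ℂ) * Complex.I)
        = Complex.exp (-θ * Complex.I) * Complex.exp (k * (-θ * Complex.I)) := by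
      rw [← Complex.exp_add]; congr 1; push_cast; ring
    have e2 : Complex.exp ((((k + 1 : ℕ) * θ : ℝ) : ℂ) * Complex.I)
        = Complex.exp (θ * Complex.I) * Complex.exp (k * (θ * Complex.I)) := by
      rw [← Complex.exp_add]; congr 1; push_cast; ring
    rw [e1, e2]; ring
  have hsum : (Real.sin θ : ℂ) / ((1 - u * Complex.exp (θ * Complex.I))
      * (1 - u * Complex.exp (-θ * Complex.I))) = Complex.I / 2 *
      (Complex.exp (-θ * Complex.I) * (1 - u * Complex.exp (-θ * Complex.I))⁻¹ -
        Complex.exp (θ * Complex.I) * (1 - u * Complex.exp (θ * Complex.I))⁻¹) := by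
    rw [Complex.ofReal_sin, Complex.sin]
    generalize Complex.exp (θ * Complex.I) = a at ha ⊢
    generalize Complex.exp (-θ * Complex.I) = b at hb ⊢
    rw [div_eq_iff (mul_ne_zero ha hb)]
    linear_combination (Complex.I / 2 * a * (1 - u * b)) * mul_inv_cancel₀ ha
      - (Complex.I / 2 * b * (1 - u * a)) * mul_inv_cancel₀ hb
  simp_rw [hterm]
  rw [hsum]
  exact h

/-- Expanding in powers of `u` and integrating termwise, only `k = 0` survives by orthogonality of
the sines, so the value does not depend on `u`. -/
theorem integral_sin_sq_div {u : ℂ} (hu : ‖u‖ < 1) :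
    ∫ θ in (0 : ℝ)..Real.pi, (Real.sin θ : ℂ) * ((Real.sin θ : ℂ) /
      ((1 - u * Complex.exp (θ * Complex.I)) * (1 - u * Complex.exp (-θ * Complex.I))))
      = Real.pi / 2 := by
  have hF : HasSum (fun k : ℕ => ∫ θ in (0 : ℝ)..Real.pi,
      (Real.sin θ : ℂ) * (u ^ k * (Real.sin ((k + 1 : ℕ) * θ) : ℂ)))
      (∫ θ in (0 : ℝ)..Real.pi, (Real.sin θ : ℂ) * ((Real.sin θ : ℂ) /
      ((1 - u * Complex.exp (θ * Complex.I)) * (1 - u * Complex.exp (-θ * Complex.I))))) := by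
    refine intervalIntegral.hasSum_integral_of_dominated_convergence
      (fun k _ => ‖u‖ ^ k) (fun k => ?_) (fun k => ?_) ?_ ?_ ?_
    · exact Continuous.aestronglyMeasurable (by fun_prop)
    · refine Filter.Eventually.of_forall fun θ _ => ?_
      rw [norm_mul, norm_mul, norm_pow, Complex.norm_real, Complex.norm_real, Real.norm_eq_abs,
        Real.norm_eq_abs]
      have h1 := Real.abs_sin_le_one θ
      have h2 := Real.abs_sin_le_one ((k + 1 : ℕ) * θ)
      calc |Real.sin θ| * (‖u‖ ^ k * |Real.sin ((k + 1 : ℕ) * θ)|)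
          ≤ 1 * (‖u‖ ^ k * 1) := by gcongr
        _ = ‖u‖ ^ k := by ring
    · exact Filter.Eventually.of_forall fun θ _ =>
        summable_geometric_of_lt_one (norm_nonneg _) hu
    · exact intervalIntegrable_const
    · exact Filter.Eventually.of_forall fun θ _ => (hasSum_pow_mul_sin hu θ).mul_left _
  refine hF.unique ?_
  have hI : ∀ k : ℕ, ∫ θ in (0 : ℝ)..Real.pi,
      (Real.sin θ : ℂ) * (u ^ k * (Real.sin ((k + 1 : ℕ) * θ) : ℂ))
      = if k = 0 then (Real.pi : ℂ) / 2 else 0 := by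
    intro k
    have : ∀ θ : ℝ, (Real.sin θ : ℂ) * (u ^ k * (Real.sin ((k + 1 : ℕ) * θ) : ℂ))
        = u ^ k * ((Real.sin θ * Real.sin ((k + 1 : ℕ) * θ) : ℝ) : ℂ) := by
      intro θ; push_cast; ring
    simp_rw [this]
    rw [intervalIntegral.integral_const_mul, intervalIntegral.integral_ofReal,
      integral_sin_mul_sin_nat]
    split_ifs with hk <;> simp [hk]
  simp_rw [hI]
  exact hasSum_ite_eq 0 _

theorem continuous_rhoSC : Continuous rhoSC := by
  unfold rhoSC; fun_prop

theorem stieltjesSC_eq_intervalIntegral (z : ℂ) :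
    stieltjesSC z = ∫ x in (-2 : ℝ)..2, 1 / ((x : ℂ) - z) * (rhoSC x : ℂ) := by
  rw [stieltjesSC, intervalIntegral.integral_of_le (by norm_num),
    ← integral_Icc_eq_integral_Ioc, setIntegral_eq_integral_of_forall_compl_eq_zero]
  intro x hx
  have : rhoSC x = 0 := by
    have h4 : 4 - x ^ 2 ≤ 0 := by
      simp only [Set.mem_Icc, not_and_or, not_le] at hx
      rcases hx with h | h <;> nlinarith
    simp [rhoSC, max_eq_right h4]
  simp [this]

/-- Under `x = -2 cos θ` the density becomes `sin θ / π`, and `x - z` factors as `-w⁻¹ (1 + w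
e^{iθ})(1 + w e^{-iθ})`. The integral is then the one of `integral_sin_sq_div` at `u = -w`. -/
theorem stieltjesSC_joukowski {w : ℂ} (hw0 : w ≠ 0) (hw : ‖w‖ < 1) (hz : 0 < (w + w⁻¹).im) :
    stieltjesSC (w + w⁻¹) = -w := by
  set z := w + w⁻¹ with hzdef
  have hxz : ∀ x : ℝ, (x : ℂ) - z ≠ 0 := by
    intro x h
    have := congrArg Complex.im h
    simp at this
    linarith
  have hcont : Continuous fun x : ℝ => 1 / ((x : ℂ) - z) * (rhoSC x : ℂ) := by
    have := continuous_rhoSC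
    refine Continuous.mul (Continuous.div continuous_const (by fun_prop) hxz) (by fun_prop)
  have hsub := intervalIntegral.integral_deriv_smul_comp (a := 0) (b := Real.pi)
    (f := fun θ : ℝ => -2 * Real.cos θ) (f' := fun θ : ℝ => 2 * Real.sin θ)
    (g := fun x : ℝ => 1 / ((x : ℂ) - z) * (rhoSC x : ℂ))
    (fun θ _ => by
      have := (Real.hasDerivAt_cos θ).const_mul (-2)
      simpa using this) (by fun_prop) hcont
  simp only [Real.cos_zero, Real.cos_pi] at hsub
  rw [stieltjesSC_eq_intervalIntegral]
  norm_num at hsub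
  norm_num
  rw [← hsub]
  have hcongr : ∀ θ ∈ Set.uIcc 0 Real.pi, 
      (2 * Real.sin θ) • (((-(2 * Real.cos θ) : ℂ) - z)⁻¹ * (rhoSC (-(2 * Real.cos θ)) : ℂ))
      = (-w * (2 / Real.pi)) * ((Real.sin θ : ℂ) * ((Real.sin θ : ℂ) /
      ((1 - (-w) * Complex.exp (θ * Complex.I)) * (1 - (-w) * Complex.exp (-θ * Complex.I))))) := by
    intro θ hθ
    rw [Set.uIcc_of_le Real.pi_pos.le] at hθ
    have hsin := Real.sin_nonneg_of_mem_Icc hθ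
    have hrho : rhoSC (-(2 * Real.cos θ)) = Real.sin θ / Real.pi := by
      have h4 : 4 - (-(2 * Real.cos θ)) ^ 2 = (2 * Real.sin θ) ^ 2 := by
        have := Real.sin_sq_add_cos_sq θ; linear_combination -4 * this
      rw [rhoSC, h4, max_eq_left (by positivity), Real.sqrt_sq (by positivity)]
      field_simp
    have ha := one_sub_mul_exp_ne_zero (u := -w) (by simpa) θ
    have hb := one_sub_mul_exp_ne_zero (u := -w) (by simpa) (-θ)
    push_cast at hb
    have e : Complex.exp (-θ * Complex.I) * Complex.exp (θ * Complex.I) = 1 := by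
      rw [← Complex.exp_add]; simp
    have hfac : (-(2 * Real.cos θ) : ℂ) - z = - w⁻¹ *
        ((1 - (-w) * Complex.exp (θ * Complex.I)) * (1 - (-w) * Complex.exp (-θ * Complex.I))) := by
      rw [hzdef, Complex.ofReal_cos, Complex.cos]
      generalize Complex.exp (θ * Complex.I) = a at e ⊢
      generalize Complex.exp (-θ * Complex.I) = b at e ⊢
      field_simp
      linear_combination w ^ 2 * e
    rw [hfac, hrho, Complex.real_smul]
    have hpi : (Real.pi : ℂ) ≠ 0 := by exact_mod_cast Real.pi_ne_zero
    push_cast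
    field_simp
  have hI := intervalIntegral.integral_congr hcongr (μ := volume)
  rw [intervalIntegral.integral_const_mul, integral_sin_sq_div (by simpa)] at hI
  have hpi : (Real.pi : ℂ) ≠ 0 := by exact_mod_cast Real.pi_ne_zero
  push_cast at hI ⊢
  simp only [Complex.real_smul] at hI ⊢
  push_cast at hI ⊢
  rw [hI]
  field_simp

/-- The semicircular Stieltjes transform solves `m² + z m + 1 = 0` and lies in the unit disc. -/
theorem stieltjesSC_spec {z : ℂ} (hz : 0 < z.im) :
    stieltjesSC z ≠ 0 ∧ ‖stieltjesSC z‖ < 1 ∧ stieltjesSC z + (stieltjesSC z)⁻¹ = -z := by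
  obtain ⟨w, hw0, hw1, rfl⟩ := exists_joukowski_of_im_pos hz
  rw [stieltjesSC_joukowski hw0 hw1 hz]
  exact ⟨neg_ne_zero.mpr hw0, by rwa [norm_neg], by rw [inv_neg]; ring⟩

theorem stieltjesSC_sub_inv_sq {z : ℂ} (hz : 0 < z.im) :
    (stieltjesSC z - (stieltjesSC z)⁻¹) ^ 2 = z ^ 2 - 4 := by
  obtain ⟨h0, -, h2⟩ := stieltjesSC_spec hz
  have h3 : stieltjesSC z * (stieltjesSC z)⁻¹ = 1 := mul_inv_cancel₀ h0
  have : z ^ 2 = (stieltjesSC z + (stieltjesSC z)⁻¹) ^ 2 := by rw [h2]; ring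
  rw [this]; linear_combination (-4) * h3

/-- A quantitative bound keeping the semicircular Stieltjes transform off the unit circle. -/
theorem im_mul_norm_stieltjesSC_le {z : ℂ} (hz : 0 < z.im) :
    z.im * ‖stieltjesSC z‖ ≤ 1 - ‖stieltjesSC z‖ ^ 2 := by
  obtain ⟨h0, h1, h2⟩ := stieltjesSC_spec hz
  set m := stieltjesSC z
  have hpos : 0 < ‖m‖ := norm_pos_iff.mpr h0
  have him := congrArg Complex.im h2
  rw [Complex.add_im, Complex.inv_im, Complex.neg_im, Complex.normSq_eq_norm_sq] at him
  have h3 : z.im * ‖m‖ ^ 2 = m.im * (1 - ‖m‖ ^ 2) := by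
    field_simp at him
    linarith
  have h4 : m.im ≤ ‖m‖ := (le_abs_self _).trans (Complex.abs_im_le_norm m)
  have h5 : 0 ≤ 1 - ‖m‖ ^ 2 := by nlinarith
  have h6 : (z.im * ‖m‖) * ‖m‖ ≤ (1 - ‖m‖ ^ 2) * ‖m‖ := by nlinarith
  exact le_of_mul_le_mul_right h6 hpos

theorem norm_stieltjesSC_le {z : ℂ} (hz : 0 < z.im) : ‖stieltjesSC z‖ ≤ 1 / z.im := by
  have := im_mul_norm_stieltjesSC_le hz
  rw [le_div_iff₀ hz]; nlinarith [sq_nonneg ‖stieltjesSC z‖]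

/-- Subtracting the two quadratic equations gives `(m - m')(1 - m m') = (z - z') m m'`. Since `|m| ≤
|m'|`, one has `|1 - m m'| ≥ 1 - |m'|² ≥ Im z' |m'|`, and the factor `|m'|` cancels. -/
theorem norm_stieltjesSC_sub_le_aux {z z' : ℂ} (hz : 0 < z.im) (hz' : 0 < z'.im)
    (hle : ‖stieltjesSC z‖ ≤ ‖stieltjesSC z'‖) :
    ‖stieltjesSC z - stieltjesSC z'‖ * z'.im ≤ ‖z - z'‖ := by
  obtain ⟨h0, h1, h2⟩ := stieltjesSC_spec hz
  obtain ⟨h0', h1', h2'⟩ := stieltjesSC_spec hz'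
  have hq := im_mul_norm_stieltjesSC_le hz'
  set m := stieltjesSC z
  set m' := stieltjesSC z'
  have hid : (m - m') * (1 - m * m') = (z - z') * (m * m') := by
    have e1 : m * m + 1 = - z * m := by rw [← h2]; field_simp
    have e2 : m' * m' + 1 = - z' * m' := by rw [← h2']; field_simp
    linear_combination m * e2 - m' * e1
  have hn := congrArg norm hid
  simp only [norm_mul] at hn
  have hpos : 0 < ‖m‖ := norm_pos_iff.mpr h0
  have hlow : z'.im * ‖m'‖ ≤ ‖1 - m * m'‖ := by
    have : (1 : ℝ) - ‖m‖ * ‖m'‖ ≤ ‖1 - m * m'‖ := by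
      have := norm_sub_norm_le (1 : ℂ) (m * m')
      rwa [norm_one, norm_mul] at this
    nlinarith [norm_nonneg m']
  have hpos' : 0 < ‖m'‖ := norm_pos_iff.mpr h0'
  have h5 : (‖m - m'‖ * z'.im) * ‖m'‖ ≤ ‖z - z'‖ * ‖m'‖ := by
    calc (‖m - m'‖ * z'.im) * ‖m'‖ = ‖m - m'‖ * (z'.im * ‖m'‖) := by ring
      _ ≤ ‖m - m'‖ * ‖1 - m * m'‖ := by gcongr
      _ = ‖z - z'‖ * (‖m‖ * ‖m'‖) := hn
      _ ≤ ‖z - z'‖ * (1 * ‖m'‖) := by gcongr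
      _ = _ := by ring
  exact le_of_mul_le_mul_right h5 hpos'

theorem norm_stieltjesSC_sub_le {z z' : ℂ} {η : ℝ} (hη : 0 < η) (hz : η ≤ z.im) (hz' : η ≤ z'.im) :
    ‖stieltjesSC z - stieltjesSC z'‖ ≤ ‖z - z'‖ / η := by
  rw [le_div_iff₀ hη]
  have hp := hη.trans_le hz
  have hp' := hη.trans_le hz'
  rcases le_total ‖stieltjesSC z‖ ‖stieltjesSC z'‖ with h | h
  · exact (mul_le_mul_of_nonneg_left hz' (norm_nonneg _)).trans
      (norm_stieltjesSC_sub_le_aux hp hp' h)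
  · rw [norm_sub_rev, norm_sub_rev z]
    exact (mul_le_mul_of_nonneg_left hz (norm_nonneg _)).trans
      (norm_stieltjesSC_sub_le_aux hp' hp h)

/-! ### Resolvents of Hermitian matrices: Ward identities, Lipschitz bounds and minors. -/

section Resolvent

variable {n : ℕ} {W : Matrix (Fin n) (Fin n) ℂ} {z : ℂ}

theorem isUnit_det_sub_smul_one (hW : W.IsHermitian) (hz : 0 < z.im) :
    IsUnit (W - z • (1 : Matrix (Fin n) (Fin n) ℂ)).det := by
  rw [isUnit_iff_ne_zero]
  intro hdet
  obtain ⟨v, hv, hv0⟩ := Matrix.exists_mulVec_eq_zero_iff.mpr hdet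
  rw [Matrix.sub_mulVec, Matrix.smul_mulVec, Matrix.one_mulVec, sub_eq_zero] at hv0
  have h1 : star v ⬝ᵥ W.mulVec v = z * (star v ⬝ᵥ v) := by
    rw [hv0, dotProduct_smul, smul_eq_mul]
  have h2 : (star v ⬝ᵥ W.mulVec v).im = 0 := by
    have h := hW.im_star_dotProduct_mulVec_self v
    simpa using h
  have h3 : star v ⬝ᵥ v = ((∑ k, ‖v k‖ ^ 2 : ℝ) : ℂ) := by
    rw [dotProduct]
    push_cast
    refine Finset.sum_congr rfl fun k _ => ?_
    rw [Pi.star_apply, RCLike.star_def, Complex.conj_mul']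
  rw [h1, h3, Complex.im_mul_ofReal] at h2
  have h4 : ∑ k, ‖v k‖ ^ 2 = 0 := (mul_eq_zero.mp h2).resolve_left hz.ne'
  rw [Finset.sum_eq_zero_iff_of_nonneg (fun _ _ => by positivity)] at h4
  refine hv (funext fun k => ?_)
  simpa using h4 k (Finset.mem_univ k)

theorem matrixResolvent_mul (hW : W.IsHermitian) (hz : 0 < z.im) :
    matrixResolvent W z * (W - z • 1) = 1 :=
  Matrix.nonsing_inv_mul _ (isUnit_det_sub_smul_one hW hz)

theorem mul_matrixResolvent (hW : W.IsHermitian) (hz : 0 < z.im) :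
    (W - z • 1) * matrixResolvent W z = 1 :=
  Matrix.mul_nonsing_inv _ (isUnit_det_sub_smul_one hW hz)

theorem conjTranspose_sub_smul_one (hW : W.IsHermitian) :
    (W - z • (1 : Matrix (Fin n) (Fin n) ℂ)).conjTranspose
      = (W - z • 1) + ((2 * z.im : ℝ) * Complex.I) • 1 := by
  rw [Matrix.conjTranspose_sub, hW.eq, Matrix.conjTranspose_smul, Matrix.conjTranspose_one]
  have : z = star z + ((2 * z.im : ℝ) * Complex.I) := by
    apply Complex.ext <;> simp; ring
  conv_rhs => rw [this, add_smul]
  simp only [Complex.star_def]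
  have h2 : (((2 * (starRingEnd ℂ z + ↑(2 * z.im) * Complex.I).im : ℝ) : ℂ) * Complex.I)
     = ((2 * z.im : ℝ) * Complex.I) := by
    congr 3; simp; ring
  rw [h2]; abel

/-- As `(W - z)* = (W - z) + 2iη`, multiplying by the resolvent and its adjoint on the two sides
gives both forms. Their diagonal entries are the Ward identities. -/
theorem matrixResolvent_sub_conjTranspose (hW : W.IsHermitian) (hz : 0 < z.im) :
    matrixResolvent W z - (matrixResolvent W z).conjTranspose =
      ((2 * z.im : ℝ) * Complex.I) • (matrixResolvent W z * (matrixResolvent W z).conjTranspose) ∧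
    matrixResolvent W z - (matrixResolvent W z).conjTranspose =
      ((2 * z.im : ℝ) * Complex.I) •
        ((matrixResolvent W z).conjTranspose * matrixResolvent W z) := by
  have h1 := matrixResolvent_mul hW hz
  have h2 := mul_matrixResolvent hW hz
  have h3 := conjTranspose_sub_smul_one (z := z) hW
  have h4 := congrArg Matrix.conjTranspose h1
  have h5 := congrArg Matrix.conjTranspose h2
  rw [Matrix.conjTranspose_mul, Matrix.conjTranspose_one, h3, add_mul] at h4
  rw [Matrix.conjTranspose_mul, Matrix.conjTranspose_one, h3, mul_add] at h5
  set R := matrixResolvent W z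
  set A := W - z • (1 : Matrix (Fin n) (Fin n) ℂ)
  constructor
  · have := congrArg (R * ·) h4
    simp only [mul_add, ← mul_assoc, h1, one_mul, mul_one, Matrix.mul_smul, Matrix.smul_mul] at this
    exact sub_eq_of_eq_add' this.symm
  · have := congrArg (· * R) h5
    simp only [add_mul, mul_assoc, h2, one_mul, mul_one, Matrix.mul_smul, Matrix.smul_mul] at this
    exact sub_eq_of_eq_add' this.symm

theorem im_eq_of_sub_star {x : ℂ} {a b : ℝ} (h : x - star x = ((2 * a : ℝ) * Complex.I) * (b : ℂ)) :
    x.im = a * b := by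
  have := congrArg Complex.im h
  simp at this
  linarith

/-- The Ward identity for the rows of the resolvent. -/
theorem sum_norm_sq_row_matrixResolvent (hW : W.IsHermitian) (hz : 0 < z.im) (k : Fin n) :
    ∑ l, ‖matrixResolvent W z k l‖ ^ 2 = (matrixResolvent W z k k).im / z.im := by
  have h := congrFun (congrFun (matrixResolvent_sub_conjTranspose hW hz).1 k) k
  rw [Matrix.sub_apply, Matrix.conjTranspose_apply, Matrix.smul_apply, Matrix.mul_apply] at h
  have h2 : ∑ l, matrixResolvent W z k l * (matrixResolvent W z).conjTranspose l k
      = ((∑ l, ‖matrixResolvent W z k l‖ ^ 2 : ℝ) : ℂ) := by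
    push_cast
    refine Finset.sum_congr rfl fun l _ => ?_
    rw [Matrix.conjTranspose_apply, RCLike.star_def, Complex.mul_conj']
  rw [h2, smul_eq_mul] at h
  rw [im_eq_of_sub_star h]
  field_simp

/-- The Ward identity for the columns of the resolvent. -/
theorem sum_norm_sq_col_matrixResolvent (hW : W.IsHermitian) (hz : 0 < z.im) (l : Fin n) :
    ∑ k, ‖matrixResolvent W z k l‖ ^ 2 = (matrixResolvent W z l l).im / z.im := by
  have h := congrFun (congrFun (matrixResolvent_sub_conjTranspose hW hz).2 l) l
  rw [Matrix.sub_apply, Matrix.conjTranspose_apply, Matrix.smul_apply, Matrix.mul_apply] at h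
  have h2 : ∑ k, (matrixResolvent W z).conjTranspose l k * matrixResolvent W z k l
      = ((∑ k, ‖matrixResolvent W z k l‖ ^ 2 : ℝ) : ℂ) := by
    push_cast
    refine Finset.sum_congr rfl fun k _ => ?_
    rw [Matrix.conjTranspose_apply, RCLike.star_def, Complex.conj_mul']
  rw [h2, smul_eq_mul] at h
  rw [im_eq_of_sub_star h]
  field_simp

theorem im_matrixResolvent_nonneg (hW : W.IsHermitian) (hz : 0 < z.im) (k : Fin n) :
    0 ≤ (matrixResolvent W z k k).im := by
  have h := sum_norm_sq_row_matrixResolvent hW hz k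
  rw [eq_div_iff hz.ne'] at h
  rw [← h]; positivity

/-- The Ward identity gives `|R_kk|² ≤ Im R_kk / η ≤ |R_kk| / η`. -/
theorem norm_matrixResolvent_diag_le (hW : W.IsHermitian) (hz : 0 < z.im) (k : Fin n) :
    ‖matrixResolvent W z k k‖ ≤ 1 / z.im := by
  have h := sum_norm_sq_row_matrixResolvent hW hz k
  have h1 : ‖matrixResolvent W z k k‖ ^ 2 ≤ ∑ l, ‖matrixResolvent W z k l‖ ^ 2 :=
    Finset.single_le_sum (f := fun l => ‖matrixResolvent W z k l‖ ^ 2) (fun _ _ => by positivity)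
      (Finset.mem_univ k)
  have h2 : (matrixResolvent W z k k).im ≤ ‖matrixResolvent W z k k‖ :=
    (le_abs_self _).trans (Complex.abs_im_le_norm _)
  rw [h, le_div_iff₀ hz] at h1
  rw [le_div_iff₀ hz]
  by_contra hcon
  push Not at hcon
  nlinarith [norm_nonneg (matrixResolvent W z k k), im_matrixResolvent_nonneg hW hz k]

theorem sum_norm_mul_norm_le {ι : Type*} (s : Finset ι) (f g : ι → ℂ) {a b : ℝ} (ha : 0 ≤ a)
    (hb : 0 ≤ b) (hf : ∑ k ∈ s, ‖f k‖ ^ 2 ≤ a ^ 2) (hg : ∑ k ∈ s, ‖g k‖ ^ 2 ≤ b ^ 2) :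
    ‖∑ k ∈ s, f k * g k‖ ≤ a * b := by
  have h1 : ‖∑ k ∈ s, f k * g k‖ ≤ ∑ k ∈ s, ‖f k‖ * ‖g k‖ :=
    (norm_sum_le _ _).trans_eq (Finset.sum_congr rfl fun k _ => norm_mul _ _)
  refine h1.trans (abs_le_of_sq_le_sq' ?_ (by positivity)).2
  calc (∑ k ∈ s, ‖f k‖ * ‖g k‖) ^ 2 ≤ (∑ k ∈ s, ‖f k‖ ^ 2) * ∑ k ∈ s, ‖g k‖ ^ 2 :=
        Finset.sum_mul_sq_le_sq_mul_sq _ _ _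
    _ ≤ a ^ 2 * b ^ 2 := by gcongr
    _ = (a * b) ^ 2 := by ring

/-- The resolvent identity `R(z) - R(z') = (z - z') R(z) R(z')`, with Cauchy–Schwarz; the Ward
identity bounds the row and the column by `1/η` in `ℓ²`. -/
theorem norm_matrixResolvent_diag_sub_le (hW : W.IsHermitian) {z z' : ℂ} {η : ℝ} (hη : 0 < η)
    (hz : η ≤ z.im) (hz' : η ≤ z'.im) (i : Fin n) :
    ‖matrixResolvent W z i i - matrixResolvent W z' i i‖ ≤ ‖z - z'‖ / η ^ 2 := by
  have hp := hη.trans_le hz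
  have hp' := hη.trans_le hz'
  have hid : matrixResolvent W z - matrixResolvent W z'
      = (z - z') • (matrixResolvent W z * matrixResolvent W z') := by
    have h1 := matrixResolvent_mul hW hp
    have h2 := mul_matrixResolvent hW hp'
    have h3 : matrixResolvent W z * ((W - z' • 1) - (W - z • 1)) * matrixResolvent W z'
        = matrixResolvent W z - matrixResolvent W z' := by
      rw [mul_sub, sub_mul, mul_assoc, h2, h1, mul_one, one_mul]
    rw [← h3]
    have : (W - z' • 1) - (W - z • (1 : Matrix (Fin n) (Fin n) ℂ)) = (z - z') • 1 := by
      rw [sub_smul]; abel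
    rw [this, Matrix.mul_smul, Matrix.mul_one, Matrix.smul_mul]
  have hbound : ∀ w : ℂ, η ≤ w.im → (matrixResolvent W w i i).im / w.im ≤ (1 / η) ^ 2 := by
    intro w hw
    have hwp := hη.trans_le hw
    have h1 := norm_matrixResolvent_diag_le hW hwp i
    have h2 : (matrixResolvent W w i i).im ≤ ‖matrixResolvent W w i i‖ :=
      (le_abs_self _).trans (Complex.abs_im_le_norm _)
    have h3 : 1 / w.im ≤ 1 / η := one_div_le_one_div_of_le hη hw
    rw [div_eq_mul_one_div, sq]
    have := one_div_pos.mpr hwp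
    gcongr
    linarith
  have hent := congrFun (congrFun hid i) i
  rw [Matrix.sub_apply, Matrix.smul_apply, Matrix.mul_apply, smul_eq_mul] at hent
  rw [hent, norm_mul]
  have := sum_norm_mul_norm_le Finset.univ (fun j => matrixResolvent W z i j)
    (fun j => matrixResolvent W z' j i) (a := 1 / η) (b := 1 / η) (by positivity) (by positivity)
    ((sum_norm_sq_row_matrixResolvent hW hp i).le.trans (hbound z hz))
    ((sum_norm_sq_col_matrixResolvent hW hp' i).le.trans (hbound z' hz'))
  calc _ ≤ ‖z - z'‖ * (1 / η * (1 / η)) := by gcongr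
    _ = _ := by field_simp

theorem stieltjes_eq_sum (W : Matrix (Fin n) (Fin n) ℂ) (z : ℂ) :
    stieltjes W z = (1 / (n : ℂ)) * ∑ i, matrixResolvent W z i i := rfl

theorem norm_average_le (hn : 0 < n) (f : Fin n → ℂ) {b : ℝ} (h : ∀ i, ‖f i‖ ≤ b) :
    ‖(1 / (n : ℂ)) * ∑ i, f i‖ ≤ b := by
  have hn' : (0 : ℝ) < n := by exact_mod_cast hn
  rw [norm_mul, norm_div, norm_one, Complex.norm_natCast, one_div, inv_mul_le_iff₀ hn']
  refine (norm_sum_le _ _).trans ((Finset.sum_le_sum fun i _ => h i).trans_eq ?_)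
  simp

theorem norm_stieltjes_le (hn : 0 < n) (hW : W.IsHermitian) (hz : 0 < z.im) :
    ‖stieltjes W z‖ ≤ 1 / z.im :=
  norm_average_le hn _ fun i => norm_matrixResolvent_diag_le hW hz i

theorem norm_stieltjes_sub_le (hn : 0 < n) (hW : W.IsHermitian) {z z' : ℂ} {η : ℝ} (hη : 0 < η)
    (hz : η ≤ z.im) (hz' : η ≤ z'.im) :
    ‖stieltjes W z - stieltjes W z'‖ ≤ ‖z - z'‖ / η ^ 2 := by
  rw [stieltjes_eq_sum, stieltjes_eq_sum, ← mul_sub, ← Finset.sum_sub_distrib]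
  exact norm_average_le hn _ fun i => norm_matrixResolvent_diag_sub_le hW hη hz hz' i

theorem im_stieltjes (W : Matrix (Fin n) (Fin n) ℂ) (z : ℂ) :
    (stieltjes W z).im = 1 / n * ∑ i, (matrixResolvent W z i i).im := by
  rw [stieltjes_eq_sum]
  have : (1 / (n : ℂ)) = ((1 / n : ℝ) : ℂ) := by push_cast; rfl
  rw [this, Complex.im_ofReal_mul, Complex.im_sum]

/-! ### Schur complement -/

/-- The matrix `W` with its `i`-th row and column replaced by zero. -/
def zeroRowCol (W : Matrix (Fin n) (Fin n) ℂ) (i : Fin n) : Matrix (Fin n) (Fin n) ℂ :=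
  Matrix.of fun k l => if k = i ∨ l = i then 0 else W k l

theorem zeroRowCol_apply (W : Matrix (Fin n) (Fin n) ℂ) (i k l : Fin n) :
    zeroRowCol W i k l = if k = i ∨ l = i then 0 else W k l := rfl

theorem isHermitian_zeroRowCol (hW : W.IsHermitian) (i : Fin n) : (zeroRowCol W i).IsHermitian := by
  ext k l
  rw [Matrix.conjTranspose_apply, zeroRowCol_apply, zeroRowCol_apply]
  by_cases h : k = i ∨ l = i
  · rw [if_pos h, if_pos h.symm, star_zero]
  · rw [if_neg h, if_neg (fun h' => h h'.symm)]
    exact hW.apply k l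

/-- The `i`-th column of `W` with its diagonal entry replaced by zero. -/
def offDiagCol (W : Matrix (Fin n) (Fin n) ℂ) (i : Fin n) : Fin n → ℂ :=
  fun k => if k = i then 0 else W k i

/-- The quadratic form of the resolvent of `zeroRowCol W i` in the column `offDiagCol W i`. -/
noncomputable def schurForm (W : Matrix (Fin n) (Fin n) ℂ) (z : ℂ) (i : Fin n) : ℂ :=
  ∑ k, ∑ l, star (offDiagCol W i k) * matrixResolvent (zeroRowCol W i) z k l * offDiagCol W i l

/-- Zeroing a row and column instead of deleting them keeps the index type. The price is a decoupled
`1 × 1` block, whose resolvent is `-1/z`. -/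
theorem matrixResolvent_zeroRowCol_row (hW : W.IsHermitian) (hz : 0 < z.im) (i l : Fin n) :
    matrixResolvent (zeroRowCol W i) z i l = if i = l then -z⁻¹ else 0 := by
  have hz0 : z ≠ 0 := fun h => by simp [h] at hz
  have h := congrFun (congrFun (mul_matrixResolvent (isHermitian_zeroRowCol hW i) hz) i) l
  rw [Matrix.mul_apply, Finset.sum_eq_single i] at h
  · rw [Matrix.sub_apply, zeroRowCol_apply, if_pos (Or.inl rfl), Matrix.smul_apply,
      Matrix.one_apply_eq, Matrix.one_apply, smul_eq_mul, mul_one, zero_sub] at h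
    split_ifs at h ⊢
    · field_simp; linear_combination -h
    · simpa [hz0] using h
  · intro k _ hk
    rw [Matrix.sub_apply, zeroRowCol_apply, if_pos (Or.inl rfl), Matrix.smul_apply,
      Matrix.one_apply_ne hk.symm]
    simp
  · simp

theorem matrixResolvent_zeroRowCol_col (hW : W.IsHermitian) (hz : 0 < z.im) {i k : Fin n}
    (hk : k ≠ i) : matrixResolvent (zeroRowCol W i) z k i = 0 := by
  have hz0 : z ≠ 0 := fun h => by simp [h] at hz
  have h := congrFun (congrFun (matrixResolvent_mul (isHermitian_zeroRowCol hW i) hz) k) i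
  rw [Matrix.mul_apply, Finset.sum_eq_single i] at h
  · rw [Matrix.sub_apply, zeroRowCol_apply, if_pos (Or.inl rfl), Matrix.smul_apply,
      Matrix.one_apply_eq, Matrix.one_apply_ne hk, smul_eq_mul, mul_one, zero_sub] at h
    simpa [hz0] using h
  · intro l _ hl
    rw [Matrix.sub_apply, zeroRowCol_apply, if_pos (Or.inr rfl), Matrix.smul_apply,
      Matrix.one_apply_ne hl]
    simp
  · simp

/-- The row of the resolvent through the Schur complement. -/
theorem schur_row (hW : W.IsHermitian) (hz : 0 < z.im) (i l : Fin n) :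
    (W i i - z - schurForm W z i) * matrixResolvent W z i l = (if i = l then 1 else 0)
      - ∑ k, star (offDiagCol W i k) * matrixResolvent (zeroRowCol W i) z k l := by
  set G := matrixResolvent (zeroRowCol W i) z with hG
  set a := offDiagCol W i with ha
  set b : Fin n → ℂ := fun l => ∑ k, star (a k) * G k l with hb
  have hai : a i = 0 := by simp [ha, offDiagCol]
  have hane : ∀ k, k ≠ i → a k = W k i := fun k hk => by simp [ha, offDiagCol, hk]
  have hbi : b i = 0 := by
    refine Finset.sum_eq_zero fun k _ => ?_
    by_cases hk : k = i
    · rw [hk, hai, star_zero, zero_mul]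
    · rw [hG, matrixResolvent_zeroRowCol_col hW hz hk, mul_zero]
  have hbA : ∀ l, ∑ k, b k * (zeroRowCol W i - z • (1 : Matrix (Fin n) (Fin n) ℂ)) k l
      = star (a l) := by
    intro l
    have h := matrixResolvent_mul (isHermitian_zeroRowCol hW i) hz
    have h' := congrFun (congrArg (Matrix.vecMul (star a)) h) l
    rw [← Matrix.vecMul_vecMul, Matrix.vecMul_one] at h'
    exact h'
  have hq : schurForm W z i = ∑ l, b l * a l := by
    rw [schurForm, Finset.sum_comm]
    exact Finset.sum_congr rfl fun l _ => (Finset.sum_mul _ _ _).symm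
  -- The row vector `e_i - b`, with `b = a* G`, is chosen to cancel all entries of `W - z` outside
  -- column `i`, leaving a multiple of `e_i`. Multiplying by the resolvent on the right then gives
  -- its `i`-th row.
  have hu : Matrix.vecMul (fun k => (if i = k then 1 else 0) - b k) (W - z • 1)
      = fun l => if i = l then W i i - z - schurForm W z i else 0 := by
    funext l
    rw [Matrix.vecMul, dotProduct]
    simp only [sub_mul, Finset.sum_sub_distrib, ite_mul, one_mul, zero_mul, Finset.sum_ite_eq,
      Finset.mem_univ, if_true]
    by_cases hl : i = l
    · subst hl
      rw [if_pos rfl, hq]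
      congr 1
      · simp
      · refine Finset.sum_congr rfl fun k _ => ?_
        by_cases hk : k = i
        · rw [hk, hbi, zero_mul, zero_mul]
        · rw [hane k hk]; simp [hk]
    · rw [if_neg hl, sub_eq_zero]
      have : ∑ k, b k * (W - z • (1 : Matrix (Fin n) (Fin n) ℂ)) k l = star (a l) := by
        rw [← hbA l]
        refine Finset.sum_congr rfl fun k _ => ?_
        by_cases hk : k = i
        · rw [hk, hbi, zero_mul, zero_mul]
        · rw [Matrix.sub_apply, Matrix.sub_apply, zeroRowCol_apply, if_neg]
          simp [hk, Ne.symm hl]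
      rw [this, hane l (Ne.symm hl), hW.apply i l]
      simp [hl]
  have h := congrFun (congrArg (fun u => Matrix.vecMul u (matrixResolvent W z)) hu) l
  simp only [Matrix.vecMul_vecMul, mul_matrixResolvent hW hz, Matrix.vecMul_one] at h
  rw [h, Matrix.vecMul, dotProduct]
  simp

theorem schur_diag (hW : W.IsHermitian) (hz : 0 < z.im) (i : Fin n) :
    (W i i - z - schurForm W z i) * matrixResolvent W z i i = 1 := by
  rw [schur_row hW hz, if_pos rfl, Finset.sum_eq_zero, sub_zero]
  intro k _
  by_cases hk : k = i
  · simp [hk, offDiagCol]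
  · rw [matrixResolvent_zeroRowCol_col hW hz hk, mul_zero]

/-- This is the minor expansion `R_kl = G_kl + R_ki R_il / R_ii`, with `1 / R_ii` replaced by its
Schur complement expression. It comes from comparing `R (W₀ - z) G` with `R (W - z) = 1`, where `W₀`
is the zeroed matrix. -/
theorem matrixResolvent_eq_zeroRowCol_add (hW : W.IsHermitian) (hz : 0 < z.im) {i : Fin n}
    (k : Fin n) {l : Fin n} (hl : l ≠ i) :
    matrixResolvent W z k l = matrixResolvent (zeroRowCol W i) z k l
      + (W i i - z - schurForm W z i) * (matrixResolvent W z k i * matrixResolvent W z i l) := by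
  have hrow := schur_row hW hz i l
  rw [if_neg (Ne.symm hl), zero_sub] at hrow
  have hrow' : (W i i - z - schurForm W z i) * (matrixResolvent W z k i * matrixResolvent W z i l)
      = - (matrixResolvent W z k i *
        ∑ m, star (offDiagCol W i m) * matrixResolvent (zeroRowCol W i) z m l) := by
    linear_combination matrixResolvent W z k i * hrow
  rw [hrow']
  set G := matrixResolvent (zeroRowCol W i) z with hG
  set R := matrixResolvent W z with hR
  have h1 : R = R * (zeroRowCol W i - z • 1) * G := by
    rw [mul_assoc, mul_matrixResolvent (isHermitian_zeroRowCol hW i) hz, mul_one]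
  have h2 : ∀ m, m ≠ i → (R * (zeroRowCol W i - z • 1)) k m
      = (if k = m then 1 else 0) - R k i * star (offDiagCol W i m) := by
    intro m hm
    have h3 := congrFun (congrFun (matrixResolvent_mul hW hz) k) m
    rw [Matrix.one_apply] at h3
    rw [← h3, Matrix.mul_apply, Matrix.mul_apply, eq_sub_iff_add_eq,
      ← Finset.add_sum_erase _ _ (Finset.mem_univ i),
      ← Finset.add_sum_erase Finset.univ _ (Finset.mem_univ i)]
    have e1 : ∑ x ∈ Finset.univ.erase i, R k x * (zeroRowCol W i - z • 1) x m
        = ∑ x ∈ Finset.univ.erase i, R k x * (W - z • 1) x m := by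
      refine Finset.sum_congr rfl fun x hx => ?_
      rw [Matrix.sub_apply, Matrix.sub_apply, zeroRowCol_apply, if_neg]
      simp [Finset.ne_of_mem_erase hx, hm]
    rw [e1]
    have e2 : star (offDiagCol W i m) = W i m := by
      rw [offDiagCol, if_neg hm, hW.apply i m]
    rw [e2, Matrix.sub_apply, Matrix.sub_apply, zeroRowCol_apply, if_pos (Or.inl rfl),
      Matrix.smul_apply, Matrix.one_apply_ne (Ne.symm hm)]
    simp only [smul_zero, sub_zero, mul_zero, zero_add, ← hR]
    ring
  have h4 : R k l = ∑ m, ((if k = m then 1 else 0) - R k i * star (offDiagCol W i m)) * G m l := by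
    conv_lhs => rw [h1]
    rw [Matrix.mul_apply]
    refine Finset.sum_congr rfl fun m _ => ?_
    by_cases hm : m = i
    · rw [hm, hG, matrixResolvent_zeroRowCol_row hW hz, if_neg (Ne.symm hl), mul_zero, mul_zero]
    · rw [h2 m hm]
  rw [h4]
  simp only [sub_mul, Finset.sum_sub_distrib, ite_mul, one_mul, zero_mul, Finset.sum_ite_eq,
    Finset.mem_univ, if_true, mul_assoc, ← Finset.mul_sum]
  ring

/-- The traces of the resolvents of a Hermitian matrix and of its minor differ by at most `1/η`. -/
theorem norm_trace_sub_sum_minor_le (hW : W.IsHermitian) (hz : 0 < z.im) (i : Fin n) :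
    ‖∑ k, matrixResolvent W z k k
      - ∑ k ∈ Finset.univ.erase i, matrixResolvent (zeroRowCol W i) z k k‖ ≤ 1 / z.im := by
  -- By the minor expansion the difference is `α ∑ R_ik R_ki` with `α = 1 / R_ii`. Cauchy–Schwarz
  -- and the Ward identities bound the sum by `Im R_ii / η`, which `α` reduces to `1/η`.
  set α := W i i - z - schurForm W z i with hα
  have hd := schur_diag hW hz i
  have hsum : ∑ k, matrixResolvent W z k k
      - ∑ k ∈ Finset.univ.erase i, matrixResolvent (zeroRowCol W i) z k k
      = α * ∑ k, matrixResolvent W z i k * matrixResolvent W z k i := by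
    rw [← Finset.add_sum_erase Finset.univ _ (Finset.mem_univ i), Finset.mul_sum,
      ← Finset.add_sum_erase Finset.univ (fun k => α * _) (Finset.mem_univ i), add_sub_assoc,
      ← Finset.sum_sub_distrib]
    congr 1
    · rw [← mul_assoc, hd, one_mul]
    · refine Finset.sum_congr rfl fun k hk => ?_
      rw [matrixResolvent_eq_zeroRowCol_add hW hz k (Finset.ne_of_mem_erase hk)]
      ring
  have hR : ‖α‖ * ‖matrixResolvent W z i i‖ = 1 := by rw [← norm_mul, hd, norm_one]
  have h0 := im_matrixResolvent_nonneg hW hz i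
  have hS := sum_norm_mul_norm_le Finset.univ (fun k => matrixResolvent W z i k)
    (fun k => matrixResolvent W z k i) (a := √((matrixResolvent W z i i).im / z.im))
    (b := √((matrixResolvent W z i i).im / z.im)) (by positivity) (by positivity)
    (by rw [Real.sq_sqrt (by positivity), sum_norm_sq_row_matrixResolvent hW hz])
    (by rw [Real.sq_sqrt (by positivity), sum_norm_sq_col_matrixResolvent hW hz])
  rw [Real.mul_self_sqrt (by positivity)] at hS
  have him : (matrixResolvent W z i i).im ≤ ‖matrixResolvent W z i i‖ :=
    (le_abs_self _).trans (Complex.abs_im_le_norm _)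
  rw [hsum, norm_mul]
  calc _ ≤ ‖α‖ * ((matrixResolvent W z i i).im / z.im) := by gcongr
    _ ≤ ‖α‖ * (‖matrixResolvent W z i i‖ / z.im) := by gcongr
    _ = 1 / z.im := by rw [← mul_div_assoc, hR]

end Resolvent

/-! ### Stability of the self-consistent equation and descent along a vertical segment. -/

section Deterministic

variable {n : ℕ} {W : Matrix (Fin n) (Fin n) ℂ} {z : ℂ}

/-- The diagonal entries of `W` and the quadratic forms of its Schur complements at `z` are
concentrated around their conditional means, with tolerance `lam`. -/
def IsConcentratedAt (W : Matrix (Fin n) (Fin n) ℂ) (z : ℂ) (lam : ℝ) : Prop :=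
  ∀ i, ‖W i i‖ ≤ lam / √n ∧
    ‖(n : ℂ) * schurForm W z i
        - ∑ k ∈ Finset.univ.erase i, matrixResolvent (zeroRowCol W i) z k k‖
      ≤ lam * √(∑ k, ∑ l, ‖matrixResolvent (zeroRowCol W i) z k l‖ ^ 2)

/-- By Ward the sum is `Im tr G / η`. Passing from `tr R` to `tr G` costs `1/η` for the minor and
`1/η` for the decoupled entry, so `Im tr G ≤ 2n + 2/η ≤ 4n`. -/
theorem sum_norm_sq_minor_le (hn : 0 < n) (hW : W.IsHermitian) (hz : 0 < z.im) (i : Fin n) {T : ℝ}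
    (hT : 1 ≤ T) (hTn : T ≤ n * z.im) (hs : (stieltjes W z).im ≤ 2) :
    ∑ k, ∑ l, ‖matrixResolvent (zeroRowCol W i) z k l‖ ^ 2 ≤ (n * (2 / √T)) ^ 2 := by
  have hn' : (0 : ℝ) < n := by exact_mod_cast hn
  have hW0 := isHermitian_zeroRowCol hW i
  set G := matrixResolvent (zeroRowCol W i) z with hG
  have h1 : ∑ k, ∑ l, ‖G k l‖ ^ 2 = (∑ k, (G k k).im) / z.im := by
    rw [Finset.sum_div]
    exact Finset.sum_congr rfl fun k _ => sum_norm_sq_row_matrixResolvent hW0 hz k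
  have h2 : (G i i).im ≤ 1 / z.im :=
    ((le_abs_self _).trans (Complex.abs_im_le_norm _)).trans (norm_matrixResolvent_diag_le hW0 hz i)
  have h3 : ∑ k ∈ Finset.univ.erase i, (G k k).im ≤ n * (stieltjes W z).im + 1 / z.im := by
    have h := norm_trace_sub_sum_minor_le hW hz i
    have h' := (neg_le_of_abs_le ((Complex.abs_im_le_norm _).trans h))
    rw [Complex.sub_im, Complex.im_sum, Complex.im_sum] at h'
    have : n * (stieltjes W z).im = ∑ k, (matrixResolvent W z k k).im := by
      rw [im_stieltjes]; field_simp
    rw [this]; linarith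
  have h4 : ∑ k, (G k k).im ≤ n * 2 + 2 / z.im := by
    rw [← Finset.add_sum_erase _ _ (Finset.mem_univ i)]
    have : n * (stieltjes W z).im ≤ n * 2 := by gcongr
    have h5 : 2 / z.im = 1 / z.im + 1 / z.im := by ring
    linarith
  have hT0 : 0 < T := by linarith
  have h6 : 2 / z.im ≤ n * 2 := by
    rw [div_le_iff₀ hz]; nlinarith
  rw [h1, mul_pow, div_pow, Real.sq_sqrt hT0.le, div_le_iff₀ hz]
  calc ∑ k, (G k k).im ≤ n * 4 := by linarith
    _ = n * 4 / T * T := by field_simp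
    _ ≤ n * 4 / T * (n * z.im) := by gcongr
    _ = _ := by ring

/-- The perturbed self-consistent equation for a diagonal entry of the resolvent. -/
theorem exists_self_consistent_error (hn : 0 < n) (hW : W.IsHermitian) (hz : 0 < z.im) {T lam : ℝ}
    (hT : 1 ≤ T) (hTn : T ≤ n * z.im) (hs : (stieltjes W z).im ≤ 2) (hlam : 0 ≤ lam)
    (hc : IsConcentratedAt W z lam) (i : Fin n) :
    ∃ Y : ℂ, ‖Y‖ ≤ lam * (1 / √n + 2 / √T) + 1 / T ∧
      matrixResolvent W z i i * (z + stieltjes W z + Y) = -1 := by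
  have hn' : (0 : ℝ) < n := by exact_mod_cast hn
  have hnc : (n : ℂ) ≠ 0 := by exact_mod_cast hn.ne'
  obtain ⟨hd, hq⟩ := hc i
  have hF := Real.sqrt_le_sqrt (sum_norm_sq_minor_le hn hW hz i hT hTn hs)
  rw [Real.sqrt_sq (by positivity)] at hF
  refine ⟨schurForm W z i - stieltjes W z - W i i, ?_, ?_⟩
  · have hT0 : 0 < T := by linarith
    -- Three errors: fluctuation of the quadratic form, trace of the minor against trace of `W`, and
    -- the diagonal entry.
    have hsplit : schurForm W z i - stieltjes W z - W i i = (1 / (n : ℂ)) *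
        ((n : ℂ) * schurForm W z i
          - ∑ k ∈ Finset.univ.erase i, matrixResolvent (zeroRowCol W i) z k k)
        - (1 / (n : ℂ)) * (∑ k, matrixResolvent W z k k
          - ∑ k ∈ Finset.univ.erase i, matrixResolvent (zeroRowCol W i) z k k) - W i i := by
      rw [stieltjes_eq_sum]; field_simp; ring
    rw [hsplit]
    have hnn : ‖(1 / (n : ℂ))‖ = 1 / n := by simp
    refine (norm_sub_le _ _).trans ((add_le_add (norm_sub_le _ _) le_rfl).trans ?_)
    rw [norm_mul, norm_mul, hnn]
    have e1 := norm_trace_sub_sum_minor_le hW hz i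
    have e2 : 1 / (n : ℝ) * (1 / z.im) ≤ 1 / T := by
      rw [one_div_mul_one_div]; exact one_div_le_one_div_of_le hT0 hTn
    calc _ ≤ 1 / (n : ℝ) * (lam * (n * (2 / √T))) + 1 / (n : ℝ) * (1 / z.im) + lam / √n := by
          gcongr
          exact hq.trans (by gcongr)
      _ ≤ 1 / (n : ℝ) * (lam * (n * (2 / √T))) + 1 / T + lam / √n := by gcongr
      _ = _ := by field_simp; ring
  · have := schur_diag hW hz i
    linear_combination -this

/-- Stability of the self-consistent equation. -/
theorem norm_sub_mul_norm_sub_inv_le (hn : 0 < n) (hW : W.IsHermitian) (hz : 0 < z.im)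
    {T lam δ : ℝ} (hT : 1 ≤ T) (hTn : T ≤ n * z.im) (hlam : 0 ≤ lam)
    (hδ : lam * (1 / √n + 2 / √T) + 1 / T ≤ δ) (hδ4 : δ ≤ 1 / 4)
    (hc : IsConcentratedAt W z lam) (hnear : ‖stieltjes W z - stieltjesSC z‖ ≤ 1 / 2) :
    ‖stieltjes W z - stieltjesSC z‖ * ‖stieltjes W z - (stieltjesSC z)⁻¹‖ ≤ 4 * δ ∧
    ∀ i, ‖matrixResolvent W z i i - stieltjesSC z‖
      ≤ 8 * δ + 2 * ‖stieltjes W z - stieltjesSC z‖ := by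
  obtain ⟨hm0, hm1, hmz⟩ := stieltjesSC_spec hz
  set m := stieltjesSC z with hm
  set s := stieltjes W z with hsdef
  have hs2 : s.im ≤ 2 := by
    have h1 : ‖s‖ ≤ 2 := by
      have := norm_add_le (s - m) m
      rw [sub_add_cancel] at this; linarith
    exact ((le_abs_self _).trans (Complex.abs_im_le_norm s)).trans h1
  have hzm : z + m = -m⁻¹ := by linear_combination hmz
  have hminv : 1 ≤ ‖m⁻¹‖ := by
    rw [norm_inv]; exact (one_le_inv₀ (norm_pos_iff.mpr hm0)).mpr hm1.le
  -- `|z + m| = 1/|m| ≥ 1`, and `s` is within `1/2` of `m`.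
  have hzs : 1 / 2 ≤ ‖z + s‖ := by
    have h1 : z + s = -m⁻¹ - -(s - m) := by rw [← hzm]; ring
    have h2 := norm_sub_norm_le (-m⁻¹) (-(s - m))
    rw [← h1, norm_neg, norm_neg] at h2
    linarith
  have hzs0 : z + s ≠ 0 := norm_pos_iff.mp (by linarith)
  have hδ0 : 0 ≤ δ := by
    have : 0 ≤ lam * (1 / √n + 2 / √T) + 1 / T := by positivity
    linarith
  have hRi : ∀ i, ‖matrixResolvent W z i i + (z + s)⁻¹‖ ≤ 2 * δ / ‖z + s‖ ^ 2 := by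
    intro i
    obtain ⟨Y, hY, hRY⟩ := exists_self_consistent_error hn hW hz hT hTn hs2 hlam hc i
    rw [← hsdef] at hRY
    have hYδ := hY.trans hδ
    have hlow : ‖z + s‖ / 2 ≤ ‖z + s + Y‖ := by
      have h2 := norm_sub_norm_le (z + s) (-Y)
      rw [norm_neg, sub_neg_eq_add] at h2
      linarith
    have h0 : z + s + Y ≠ 0 := norm_pos_iff.mp (by linarith)
    have hR : matrixResolvent W z i i = -(z + s + Y)⁻¹ := by
      field_simp; linear_combination hRY
    have : matrixResolvent W z i i + (z + s)⁻¹ = Y / ((z + s) * (z + s + Y)) := by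
      rw [hR]; field_simp; ring
    rw [this, norm_div, norm_mul]
    calc ‖Y‖ / (‖z + s‖ * ‖z + s + Y‖) ≤ δ / (‖z + s‖ * (‖z + s‖ / 2)) := by gcongr
      _ = _ := by field_simp
  have hpos : 0 < ‖z + s‖ := by linarith
  have hn' : (n : ℂ) ≠ 0 := by exact_mod_cast hn.ne'
  have hav : ‖s + (z + s)⁻¹‖ ≤ 2 * δ / ‖z + s‖ ^ 2 := by
    have h := norm_average_le hn _ hRi
    rw [Finset.sum_add_distrib, mul_add, ← stieltjes_eq_sum, ← hsdef] at h
    simpa [hn'] using h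
  constructor
  -- Both sides equal `s² + z s + 1`, whose roots are `m` and `m⁻¹`.
  · have hprod : (s - m) * (s - m⁻¹) = (z + s) * (s + (z + s)⁻¹) := by
      have e1 : m * m⁻¹ = 1 := mul_inv_cancel₀ hm0
      have e2 : (z + s) * (z + s)⁻¹ = 1 := mul_inv_cancel₀ hzs0
      linear_combination e1 - e2 - s * hmz
    rw [← norm_mul, hprod, norm_mul]
    calc ‖z + s‖ * ‖s + (z + s)⁻¹‖ ≤ ‖z + s‖ * (2 * δ / ‖z + s‖ ^ 2) := by gcongr
      _ = 2 * δ / ‖z + s‖ := by field_simp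
      _ ≤ 2 * δ / (1 / 2) := by gcongr
      _ = 4 * δ := by ring
  · intro i
    have h1 : matrixResolvent W z i i - m = (matrixResolvent W z i i + (z + s)⁻¹)
        + m * ((z + s)⁻¹ * (m - s)) := by
      have e1 : (z + s)⁻¹ = -m + -m * (z+s)⁻¹ * (m - s) := by
        have : m * (z + s) = -1 + m * (s - m) := by
          have : m * (z + m) = -1 := by rw [hzm]; field_simp
          linear_combination this
        field_simp
        linear_combination this
      linear_combination -e1
    rw [h1]
    refine (norm_add_le _ _).trans (add_le_add ((hRi i).trans ?_) ?_)
    · calc 2 * δ / ‖z + s‖ ^ 2 ≤ 2 * δ / (1 / 2) ^ 2 := by gcongr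
        _ = 8 * δ := by ring
    · rw [norm_mul, norm_mul, norm_inv, norm_sub_rev m s]
      have : ‖z + s‖⁻¹ ≤ 2 := by
        rw [inv_le_comm₀ hpos (by norm_num)]; linarith
      calc ‖m‖ * (‖z + s‖⁻¹ * ‖s - m‖) ≤ 1 * (2 * ‖s - m‖) := by gcongr
        _ = _ := one_mul _

theorem norm_sub_mul_I_le (E : ℝ) {y y' : ℝ} :
    ‖((E : ℂ) + (y : ℂ) * Complex.I) - ((E : ℂ) + (y' : ℂ) * Complex.I)‖ = |y - y'| := by
  rw [add_sub_add_left_eq_sub, ← sub_mul, norm_mul, Complex.norm_I, mul_one, ← Complex.ofReal_sub,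
    Complex.norm_real, Real.norm_eq_abs]

/-- The distance between the two roots of `X² + z X + 1` increases along vertical lines. -/
theorem norm_stieltjesSC_sub_inv_mono (E : ℝ) {y y' : ℝ} (hy : 0 < y) (hyy' : y ≤ y') :
    ‖stieltjesSC (E + y * Complex.I) - (stieltjesSC (E + y * Complex.I))⁻¹‖
      ≤ ‖stieltjesSC (E + y' * Complex.I) - (stieltjesSC (E + y' * Complex.I))⁻¹‖ := by
  have hsq : ∀ t : ℝ, 0 < t →
      ‖stieltjesSC (E + t * Complex.I) - (stieltjesSC (E + t * Complex.I))⁻¹‖ ^ 2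
      = ‖((E - 2 : ℝ) : ℂ) + t * Complex.I‖ * ‖((E + 2 : ℝ) : ℂ) + t * Complex.I‖ := by
    intro t ht
    rw [← norm_pow, stieltjesSC_sub_inv_sq (by simpa using ht), ← norm_mul]
    congr 1; push_cast; ring
  have hmono : ∀ a : ℝ, ‖(a : ℂ) + y * Complex.I‖ ≤ ‖(a : ℂ) + y' * Complex.I‖ := by
    intro a
    rw [Complex.norm_add_mul_I, Complex.norm_add_mul_I]
    exact Real.sqrt_le_sqrt (by gcongr)
  refine (abs_le_of_sq_le_sq' ?_ (norm_nonneg _)).2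
  rw [hsq y hy, hsq y' (hy.trans_le hyy')]
  exact mul_le_mul (hmono _) (hmono _) (norm_nonneg _) (norm_nonneg _)

/-- The local law on a whole vertical segment follows from concentration on a fine grid. -/
theorem local_law_of_isConcentratedAt (hn : 0 < n) (hW : W.IsHermitian) {E η T lam δ r : ℝ}
    (hη : 0 < η) (hT : 1 ≤ T) (hTn : T ≤ n * η) (hlam : 0 ≤ lam)
    (hδ : lam * (1 / √n + 2 / √T) + 1 / T ≤ δ) (hr : 0 < r) (hδr : 4 * δ ≤ r ^ 2)
    (hr20 : r ≤ 1 / 20) (hrn : 80 / (n : ℝ) ^ 2 ≤ r)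
    (hc : ∀ k ∈ Finset.range (n ^ 4 + 1), IsConcentratedAt W
      (E + ((η + 4 * (1 - k / (n : ℝ) ^ 4) : ℝ) : ℂ) * Complex.I) lam) :
    ‖stieltjes W (E + η * Complex.I) - stieltjesSC (E + η * Complex.I)‖ ≤ 12 * r ∧
    ∀ i, ‖matrixResolvent W (E + η * Complex.I) i i - stieltjesSC (E + η * Complex.I)‖
      ≤ 12 * r := by
  have hn' : (0 : ℝ) < n := by exact_mod_cast hn
  have hn1 : (1 : ℝ) ≤ n := by exact_mod_cast hn
  have hδ4 : δ ≤ 1 / 4 := by nlinarith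
  have him : ∀ y : ℝ, ((E : ℂ) + (y : ℂ) * Complex.I).im = y := fun y => by simp
  set y : ℕ → ℝ := fun k => η + 4 * (1 - k / (n : ℝ) ^ 4) with hy
  set d : ℕ → ℂ := fun k => stieltjes W (E + (y k : ℝ) * Complex.I)
    - stieltjesSC (E + (y k : ℝ) * Complex.I) with hd
  have hyη : ∀ k ≤ n ^ 4, η ≤ y k := by
    intro k hk
    have : (k : ℝ) / (n : ℝ) ^ 4 ≤ 1 := by
      rw [div_le_one (by positivity)]; exact_mod_cast hk
    simp only [hy]; linarith
  have hstab : ∀ k ≤ n ^ 4, ‖d k‖ ≤ 1 / 2 →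
      ‖d k‖ * ‖stieltjes W (E + (y k : ℝ) * Complex.I)
        - (stieltjesSC (E + (y k : ℝ) * Complex.I))⁻¹‖ ≤ 4 * δ ∧
      ∀ i, ‖matrixResolvent W (E + (y k : ℝ) * Complex.I) i i
        - stieltjesSC (E + (y k : ℝ) * Complex.I)‖ ≤ 8 * δ + 2 * ‖d k‖ := by
    intro k hk hdk
    refine norm_sub_mul_norm_sub_inv_le hn hW ?_ hT ?_ hlam hδ hδ4
      (hc k (Finset.mem_range.mpr (by omega))) hdk
    · rw [him]; exact hη.trans_le (hyη k hk)
    · rw [him]; exact hTn.trans (by gcongr; exact hyη k hk)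
  -- The sharp bound `r` holds while the roots are at least `4r` apart; otherwise both roots lie
  -- close together and `5r` is enough. By monotonicity of the separation, the sharp bound at one
  -- grid point is available from the preceding, higher one.
  have hmain : ∀ k ≤ n ^ 4, ‖d k‖ ≤ 5 * r ∧
      (4 * r ≤ ‖stieltjesSC (E + (y k : ℝ) * Complex.I)
        - (stieltjesSC (E + (y k : ℝ) * Complex.I))⁻¹‖ → ‖d k‖ ≤ r) := by
    intro k
    induction k with
    | zero =>
      intro _
      -- At height at least `4` both `|s|` and `|m|` are at most `1/4`, so `s` is at distance at
      -- least `1` from `m⁻¹`.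
      have hy0 : 4 ≤ y 0 := by simp only [hy]; simp; linarith
      have hp : 0 < ((E : ℂ) + (y 0 : ℝ) * Complex.I).im := by rw [him]; linarith
      have h1 := norm_stieltjes_le hn hW hp
      have h2 := norm_stieltjesSC_le hp
      obtain ⟨hm0, hm1, -⟩ := stieltjesSC_spec hp
      have hq := im_mul_norm_stieltjesSC_le hp
      rw [him] at h1 h2 hq
      have h3 : 1 / y 0 ≤ 1 / 4 := one_div_le_one_div_of_le (by norm_num) hy0
      set m := stieltjesSC (E + (y 0 : ℝ) * Complex.I)
      set s := stieltjes W (E + (y 0 : ℝ) * Complex.I)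
      have hpos : 0 < ‖m‖ := norm_pos_iff.mpr hm0
      have hminv : 2 ≤ ‖m⁻¹‖ := by
        rw [norm_inv, le_inv_comm₀ (by norm_num) hpos]; linarith
      have hfar : 1 ≤ ‖s - m⁻¹‖ := by
        have := norm_sub_norm_le m⁻¹ s
        rw [norm_sub_rev] at this; linarith
      have hd0 : ‖d 0‖ ≤ 1 / 2 := by
        exact (norm_sub_le s m).trans (by linarith)
      have := (hstab 0 (Nat.zero_le _) hd0).1
      have h5 : ‖d 0‖ ≤ r := by nlinarith [norm_nonneg (d 0)]
      exact ⟨by linarith, fun _ => h5⟩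
    | succ k ih =>
      intro hk
      have hk' : k ≤ n ^ 4 := by omega
      obtain ⟨ih1, ih2⟩ := ih hk'
      have hstep : y k - y (k + 1) = 4 / (n : ℝ) ^ 4 := by
        simp only [hy]; push_cast; field_simp; ring
      have hz1 := hyη k hk'
      have hz2 := hyη (k + 1) hk
      -- Since `1/η ≤ n`, the Lipschitz constants are at most `n²`. A step of `4/n⁴` thus moves each
      -- of `s` and `m` by at most `4/n²`, and `80/n² ≤ r` closes the bound.
      have hgap : ‖d (k + 1) - d k‖ ≤ r / 10 := by
        have hi1 : η ≤ ((E : ℂ) + (y k : ℝ) * Complex.I).im := by rw [him]; exact hz1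
        have hi2 : η ≤ ((E : ℂ) + (y (k + 1) : ℝ) * Complex.I).im := by rw [him]; exact hz2
        have e1 := norm_stieltjes_sub_le hn hW hη hi2 hi1
        have e2 := norm_stieltjesSC_sub_le hη hi2 hi1
        rw [norm_sub_mul_I_le, abs_sub_comm, hstep, abs_of_nonneg (by positivity)] at e1 e2
        have hηn : 1 / η ≤ n := by rw [div_le_iff₀ hη]; linarith
        have hη0 : 0 ≤ 1 / η := by positivity
        have e3 : 4 / (n : ℝ) ^ 4 / η ^ 2 ≤ 4 / (n : ℝ) ^ 2 := by
          calc 4 / (n : ℝ) ^ 4 / η ^ 2 = 4 / (n : ℝ) ^ 4 * (1 / η) ^ 2 := by field_simp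
            _ ≤ 4 / (n : ℝ) ^ 4 * (n : ℝ) ^ 2 := by gcongr
            _ = _ := by field_simp
        have e4 : 4 / (n : ℝ) ^ 4 / η ≤ 4 / (n : ℝ) ^ 2 := by
          calc 4 / (n : ℝ) ^ 4 / η = 4 / (n : ℝ) ^ 4 * (1 / η) := by field_simp
            _ ≤ 4 / (n : ℝ) ^ 4 * (n : ℝ) := by gcongr
            _ ≤ 4 / (n : ℝ) ^ 4 * (n : ℝ) ^ 2 := by gcongr; nlinarith
            _ = _ := by field_simp
        have e5 : 80 / (n : ℝ) ^ 2 = 10 * (4 / (n : ℝ) ^ 2 + 4 / (n : ℝ) ^ 2) := by ring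
        have : d (k + 1) - d k
            = (stieltjes W (E + (y (k + 1) : ℝ) * Complex.I) - stieltjes W (E + (y k : ℝ) * Complex.I))
            - (stieltjesSC (E + (y (k + 1) : ℝ) * Complex.I)
              - stieltjesSC (E + (y k : ℝ) * Complex.I)) := by simp only [hd]; ring
        rw [this]
        refine (norm_sub_le _ _).trans ?_
        linarith
      have htri : ‖d (k + 1)‖ ≤ ‖d k‖ + r / 10 := by
        have := norm_add_le (d (k + 1) - d k) (d k)
        rw [sub_add_cancel] at this; linarith
      have hD := norm_stieltjesSC_sub_inv_mono E (hη.trans_le hz2)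
        (show y (k + 1) ≤ y k by
          have : (0 : ℝ) ≤ 4 / (n : ℝ) ^ 4 := by positivity
          linarith)
      have hst := (hstab (k + 1) hk (by linarith)).1
      set m := stieltjesSC (E + (y (k + 1) : ℝ) * Complex.I)
      set s := stieltjes W (E + (y (k + 1) : ℝ) * Complex.I)
      have hsplit : ‖m - m⁻¹‖ ≤ ‖d (k + 1)‖ + ‖s - m⁻¹‖ := by
        have : m - m⁻¹ = -(s - m) + (s - m⁻¹) := by ring
        rw [this]
        exact (norm_add_le _ _).trans_eq (by rw [norm_neg])
      have hsplit' : ‖d (k + 1)‖ ≤ ‖m - m⁻¹‖ + ‖s - m⁻¹‖ := by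
        have : d (k + 1) = (s - m⁻¹) - (m - m⁻¹) := by simp only [hd]; ring
        rw [this]
        exact (norm_sub_le _ _).trans_eq (add_comm _ _)
      have hlarge : 4 * r ≤ ‖m - m⁻¹‖ → ‖d (k + 1)‖ ≤ r := by
        intro hDr
        have h1 := ih2 (hDr.trans hD)
        have h2 : r ≤ ‖s - m⁻¹‖ := by linarith
        by_contra hcon
        push Not at hcon
        nlinarith
      refine ⟨?_, hlarge⟩
      by_cases hDr : 4 * r ≤ ‖m - m⁻¹‖
      · linarith [hlarge hDr]
      · push Not at hDr
        by_contra hcon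
        push Not at hcon
        have h2 : r ≤ ‖s - m⁻¹‖ := by linarith
        nlinarith
  have hlast : y (n ^ 4) = η := by
    simp only [hy]; push_cast; field_simp; ring
  have h1 := (hmain (n ^ 4) le_rfl).1
  have h2 := (hstab (n ^ 4) le_rfl (by linarith)).2
  simp only [hd, hlast] at h1 h2
  refine ⟨by linarith, fun i => (h2 i).trans ?_⟩
  nlinarith
end Deterministic

/-! ### A moment inequality for adding one independent centred term. -/

section Hypercontractivity

/-- In the binomial expansion of the difference every term is nonnegative because `|B| ≤ B'`; only
the linear one is kept. -/
theorem mul_sub_le_pow_sub_pow {A B B' : ℝ} (hA : 0 ≤ A) (hB : |B| ≤ B') {p : ℕ} (hp : 1 ≤ p) :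
    p * A ^ (p - 1) * (B' - B) ≤ (A + B') ^ p - (A + B) ^ p := by
  rw [add_comm A, add_comm A, add_pow, add_pow, ← Finset.sum_sub_distrib]
  have hterm : ∀ j, B ^ j ≤ B' ^ j := fun j =>
    (le_abs_self _).trans ((abs_pow B j).le.trans (pow_le_pow_left₀ (abs_nonneg B) hB j))
  have h := Finset.single_le_sum
    (f := fun j => B' ^ j * A ^ (p - j) * (p.choose j) - B ^ j * A ^ (p - j) * (p.choose j))
    (s := Finset.range (p + 1)) (fun j _ => by
      rw [mul_assoc, mul_assoc, ← sub_mul]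
      exact mul_nonneg (sub_nonneg.mpr (hterm j)) (by positivity))
    (Finset.mem_range.mpr (by omega : 1 < p + 1))
  refine le_trans (le_of_eq ?_) h
  simp only [pow_one, Nat.choose_one_right]
  ring

/-- This bounds the power by its scalar majorant while trading the linear term `|x||w|` for `Re
(conj x · w)`, which has mean zero when `w` is centred. It is `mul_sub_le_pow_sub_pow` with `A =
|x|²`. -/
theorem norm_add_pow_le (x w : ℂ) {p : ℕ} (hp : 1 ≤ p) :
    ‖x + w‖ ^ (2 * p) ≤ (‖x‖ + ‖w‖) ^ (2 * p) - 2 * p * ‖x‖ ^ (2 * p - 1) * ‖w‖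
      + 2 * p * ‖x‖ ^ (2 * p - 2) * ((starRingEnd ℂ) x * w).re := by
  have h1 : ‖x + w‖ ^ 2 = ‖x‖ ^ 2 + (2 * ((starRingEnd ℂ) x * w).re + ‖w‖ ^ 2) := by
    rw [← Complex.normSq_eq_norm_sq, ← Complex.normSq_eq_norm_sq, ← Complex.normSq_eq_norm_sq]
    simp [Complex.normSq_apply]; ring
  have h2 : (‖x‖ + ‖w‖) ^ 2 = ‖x‖ ^ 2 + (2 * (‖x‖ * ‖w‖) + ‖w‖ ^ 2) := by ring
  have hre : |((starRingEnd ℂ) x * w).re| ≤ ‖x‖ * ‖w‖ := by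
    refine (Complex.abs_re_le_norm _).trans ?_
    rw [norm_mul, RCLike.norm_conj]
  have hB : |2 * ((starRingEnd ℂ) x * w).re + ‖w‖ ^ 2| ≤ 2 * (‖x‖ * ‖w‖) + ‖w‖ ^ 2 := by
    refine (abs_add_le _ _).trans ?_
    rw [abs_mul, abs_two, abs_of_nonneg (sq_nonneg ‖w‖)]
    linarith
  have h := mul_sub_le_pow_sub_pow (sq_nonneg ‖x‖) hB hp
  rw [← h1, ← h2, ← pow_mul, ← pow_mul, ← pow_mul] at h
  obtain ⟨m, rfl⟩ : ∃ m, p = m + 1 := ⟨p - 1, by omega⟩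
  have e1 : 2 * (m + 1) - 1 = 2 * m + 1 := by omega
  have e2 : 2 * (m + 1) - 2 = 2 * m := by omega
  rw [Nat.add_sub_cancel] at h
  rw [e1, e2, pow_succ ‖x‖ (2 * m)]
  linarith

/-- If `X < 2pβ`, then already `(X + β)² ≤ X² + (4p + 1)β²`. Otherwise `w = β/X` has `2pw ≤ 1`, and
`(1 + w)^(2p) ≤ e^(2pw) ≤ 1 + 2pw + (2pw)²` is compared with Bernoulli's inequality. -/
theorem add_pow_sub_le {X β : ℝ} (hX : 0 ≤ X) (hβ : 0 ≤ β) {p : ℕ} (hp : 1 ≤ p) :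
    (X + β) ^ (2 * p) - 2 * p * X ^ (2 * p - 1) * β ≤ (X ^ 2 + (4 * p + 1) * β ^ 2) ^ p := by
  have hp' : (1 : ℝ) ≤ p := by exact_mod_cast hp
  rcases lt_or_ge X (2 * p * β) with h | h
  · have h1 : (X + β) ^ 2 ≤ X ^ 2 + (4 * p + 1) * β ^ 2 := by nlinarith
    have h2 : (X + β) ^ (2 * p) ≤ (X ^ 2 + (4 * p + 1) * β ^ 2) ^ p := by
      rw [pow_mul]; exact pow_le_pow_left₀ (by positivity) h1 p
    have : 0 ≤ 2 * p * X ^ (2 * p - 1) * β := by positivity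
    linarith
  · rcases hX.eq_or_lt with h0 | hX0
    · have hβ0 : β = 0 := by
        rw [← h0] at h; nlinarith
      rw [hβ0, ← h0]
      simp [pow_mul]
    · set w := β / X with hw
      have hβw : β = w * X := by rw [hw]; field_simp
      have hw0 : 0 ≤ w := by positivity
      have hw1 : 2 * p * w ≤ 1 := by
        rw [hw, ← mul_div_assoc, div_le_one hX0]; exact h
      have hexp : (1 + w) ^ (2 * p) ≤ 1 + 2 * p * w + (2 * p * w) ^ 2 := by
        have h1 : (1 + w) ^ (2 * p) ≤ Real.exp (2 * p * w) := by
          have : Real.exp (2 * p * w) = Real.exp w ^ (2 * p) := by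
            rw [← Real.exp_nat_mul]; push_cast; ring_nf
          rw [this]
          exact pow_le_pow_left₀ (by positivity) (by linarith [Real.add_one_le_exp w]) _
        have h2 := (abs_le.mp (Real.abs_exp_sub_one_sub_id_le (x := 2 * p * w)
          (by rw [abs_of_nonneg (by positivity)]; exact hw1))).2
        linarith
      have hbern : 1 + (p : ℝ) * ((4 * p + 1) * w ^ 2) ≤ (1 + (4 * p + 1) * w ^ 2) ^ p :=
        one_add_mul_le_pow (by nlinarith [sq_nonneg w]) p
      have hscalar : (1 + w) ^ (2 * p) - 2 * p * w ≤ (1 + (4 * p + 1) * w ^ 2) ^ p := by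
        nlinarith [sq_nonneg w]
      have e1 : (X + β) ^ (2 * p) = X ^ (2 * p) * (1 + w) ^ (2 * p) := by
        rw [← mul_pow, hβw]; ring
      have e2 : X ^ (2 * p - 1) * β = X ^ (2 * p) * w := by
        obtain ⟨m, rfl⟩ : ∃ m, p = m + 1 := ⟨p - 1, by omega⟩
        have : 2 * (m + 1) - 1 = 2 * m + 1 := by omega
        rw [this, hβw]; ring
      have e3 : (X ^ 2 + (4 * p + 1) * β ^ 2) ^ p
          = X ^ (2 * p) * (1 + (4 * p + 1) * w ^ 2) ^ p := by
        rw [pow_mul, ← mul_pow, hβw]; ring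
      rw [e1, e3, mul_assoc (2 * (p : ℝ)), e2]
      have : 0 ≤ X ^ (2 * p) := by positivity
      nlinarith

variable {Ω : Type*} [MeasurableSpace Ω] {P : Measure Ω}

/-- The absolute moments of `ξ` up to order `q` are bounded by the powers of `μ`. -/
def HasMomentBound (P : Measure Ω) (ξ : Ω → ℂ) (q : ℕ) (μ : ℝ) : Prop :=
  ∀ j ≤ q, Integrable (fun ω => ‖ξ ω‖ ^ j) P ∧ ∫ ω, ‖ξ ω‖ ^ j ∂P ≤ μ ^ j

theorem lintegral_norm_add_mul_pow_le {ξ : Ω → ℂ} (hξ : Measurable ξ) (h0 : ∫ ω, ξ ω ∂P = 0)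
    {p : ℕ} (hp : 1 ≤ p) {μ : ℝ} (hμ : 0 ≤ μ) (hmom : HasMomentBound P ξ (2 * p) μ) (x y : ℂ) :
    ∫⁻ ω, ENNReal.ofReal (‖x + ξ ω * y‖ ^ (2 * p)) ∂P
      ≤ ENNReal.ofReal ((‖x‖ ^ 2 + (4 * p + 1) * μ ^ 2 * ‖y‖ ^ 2) ^ p) := by
  have hξint : Integrable ξ P := by
    have := (hmom 1 (by omega)).1
    simp only [pow_one] at this
    exact (integrable_norm_iff hξ.aestronglyMeasurable).mp this
  have hbint : ∀ j ≤ 2 * p, Integrable (fun ω => (‖ξ ω‖ * ‖y‖) ^ j) P := fun j hj => by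
    simp_rw [mul_pow]; exact (hmom j hj).1.mul_const _
  have hbmom : ∀ j ≤ 2 * p, ∫ ω, (‖ξ ω‖ * ‖y‖) ^ j ∂P ≤ (μ * ‖y‖) ^ j := fun j hj => by
    simp_rw [mul_pow]
    rw [integral_mul_const]
    exact mul_le_mul_of_nonneg_right (hmom j hj).2 (by positivity)
  have hexpand : ∀ b : ℝ, (‖x‖ + b) ^ (2 * p)
      = ∑ j ∈ Finset.range (2 * p + 1), b ^ j * (‖x‖ ^ (2 * p - j) * ((2 * p).choose j)) := by
    intro b
    rw [add_comm, add_pow]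
    exact Finset.sum_congr rfl fun j _ => by ring
  have hterm_int : ∀ j ∈ Finset.range (2 * p + 1), Integrable
      (fun ω => (‖ξ ω‖ * ‖y‖) ^ j * (‖x‖ ^ (2 * p - j) * ((2 * p).choose j))) P := fun j hj =>
    (hbint j (by have := Finset.mem_range.mp hj; omega)).mul_const _
  have hpow_int : Integrable (fun ω => (‖x‖ + ‖ξ ω‖ * ‖y‖) ^ (2 * p)) P := by
    simp_rw [hexpand]; exact integrable_finsetSum _ hterm_int
  have hb1 : Integrable (fun ω => ‖ξ ω‖ * ‖y‖) P := by simpa using hbint 1 (by omega)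
  -- With the linear term removed, the expansion in `|ξ||y|` has nonnegative coefficients, so each
  -- moment may be replaced by its bound.
  have hmain : ∫ ω, (‖x‖ + ‖ξ ω‖ * ‖y‖) ^ (2 * p) ∂P
      - 2 * p * ‖x‖ ^ (2 * p - 1) * ∫ ω, ‖ξ ω‖ * ‖y‖ ∂P
      ≤ (‖x‖ + μ * ‖y‖) ^ (2 * p) - 2 * p * ‖x‖ ^ (2 * p - 1) * (μ * ‖y‖) := by
    have hsum : ∫ ω, (‖x‖ + ‖ξ ω‖ * ‖y‖) ^ (2 * p) ∂P = ∑ j ∈ Finset.range (2 * p + 1),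
        (∫ ω, (‖ξ ω‖ * ‖y‖) ^ j ∂P) * (‖x‖ ^ (2 * p - j) * ((2 * p).choose j)) := by
      simp_rw [hexpand]
      rw [integral_finsetSum _ hterm_int]
      exact Finset.sum_congr rfl fun j _ => integral_mul_const _ _
    have h := Finset.single_le_sum (f := fun j => ((μ * ‖y‖) ^ j - ∫ ω, (‖ξ ω‖ * ‖y‖) ^ j ∂P)
      * (‖x‖ ^ (2 * p - j) * ((2 * p).choose j))) (s := Finset.range (2 * p + 1))
      (fun j hj => mul_nonneg (sub_nonneg.mpr
        (hbmom j (by have := Finset.mem_range.mp hj; omega))) (by positivity))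
      (Finset.mem_range.mpr (by omega : 1 < 2 * p + 1))
    simp only [sub_mul, Finset.sum_sub_distrib, pow_one, Nat.choose_one_right] at h
    rw [← hsum, ← hexpand] at h
    push_cast at h
    linarith
  have hcross : Integrable (fun ω => ((starRingEnd ℂ) x * (ξ ω * y)).re) P :=
    ((hξint.mul_const y).const_mul _).re
  have hcross0 : ∫ ω, ((starRingEnd ℂ) x * (ξ ω * y)).re ∂P = 0 := by
    have := integral_re (𝕜 := ℂ) ((hξint.mul_const y).const_mul ((starRingEnd ℂ) x))
    rw [integral_const_mul, integral_mul_const, h0] at this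
    simpa using this
  have hpw : ∀ ω, ‖x + ξ ω * y‖ ^ (2 * p) ≤ (‖x‖ + ‖ξ ω‖ * ‖y‖) ^ (2 * p)
      - 2 * p * ‖x‖ ^ (2 * p - 1) * (‖ξ ω‖ * ‖y‖)
      + 2 * p * ‖x‖ ^ (2 * p - 2) * ((starRingEnd ℂ) x * (ξ ω * y)).re := fun ω => by
    have := norm_add_pow_le x (ξ ω * y) hp
    rwa [norm_mul] at this
  have hR_int : Integrable (fun ω => (‖x‖ + ‖ξ ω‖ * ‖y‖) ^ (2 * p)
      - 2 * p * ‖x‖ ^ (2 * p - 1) * (‖ξ ω‖ * ‖y‖)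
      + 2 * p * ‖x‖ ^ (2 * p - 2) * ((starRingEnd ℂ) x * (ξ ω * y)).re) P :=
    (hpow_int.sub (hb1.const_mul _)).add (hcross.const_mul _)
  calc ∫⁻ ω, ENNReal.ofReal (‖x + ξ ω * y‖ ^ (2 * p)) ∂P
      ≤ ∫⁻ ω, ENNReal.ofReal ((‖x‖ + ‖ξ ω‖ * ‖y‖) ^ (2 * p)
      - 2 * p * ‖x‖ ^ (2 * p - 1) * (‖ξ ω‖ * ‖y‖)
      + 2 * p * ‖x‖ ^ (2 * p - 2) * ((starRingEnd ℂ) x * (ξ ω * y)).re) ∂P :=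
        lintegral_mono fun ω => ENNReal.ofReal_le_ofReal (hpw ω)
    _ = ENNReal.ofReal (∫ ω, ((‖x‖ + ‖ξ ω‖ * ‖y‖) ^ (2 * p)
      - 2 * p * ‖x‖ ^ (2 * p - 1) * (‖ξ ω‖ * ‖y‖)
      + 2 * p * ‖x‖ ^ (2 * p - 2) * ((starRingEnd ℂ) x * (ξ ω * y)).re) ∂P) :=
        (ofReal_integral_eq_lintegral_ofReal hR_int (Filter.Eventually.of_forall fun ω =>
          le_trans (by positivity) (hpw ω))).symm
    _ ≤ _ := by
        refine ENNReal.ofReal_le_ofReal ?_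
        have hsub_int : Integrable (fun ω => (‖x‖ + ‖ξ ω‖ * ‖y‖) ^ (2 * p)
            - 2 * p * ‖x‖ ^ (2 * p - 1) * (‖ξ ω‖ * ‖y‖)) P := hpow_int.sub (hb1.const_mul _)
        rw [integral_add hsub_int (hcross.const_mul _),
          integral_sub hpow_int (hb1.const_mul _), integral_const_mul, integral_const_mul, hcross0,
          mul_zero, add_zero]
        refine hmain.trans ((add_pow_sub_le (norm_nonneg x) (by positivity) hp).trans_eq ?_)
        ring

/-- The `L^p` norm of `‖X‖²`, that is, the square of the `L^(2p)` norm of `X`. -/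
noncomputable def sqMoment (P : Measure Ω) (p : ℕ) (X : Ω → ℂ) : ENNReal :=
  eLpNorm (fun ω => ‖X ω‖ ^ 2) p P

/-- By Fubini the scalar inequality applies with `(X, Y)` frozen; Minkowski in `L^p` then separates
`|X|²` from `|Y|²`. Working with the norm of the square makes contributions add like variances. -/
theorem sqMoment_add_mul_le [IsProbabilityMeasure P] {ξ X Y : Ω → ℂ} (hξ : Measurable ξ) (hX : Measurable X)
    (hY : Measurable Y) (hind : IndepFun (fun ω => (X ω, Y ω)) ξ P) (h0 : ∫ ω, ξ ω ∂P = 0)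
    {p : ℕ} (hp : 1 ≤ p) {μ : ℝ} (hμ : 0 ≤ μ) (hmom : HasMomentBound P ξ (2 * p) μ) :
    sqMoment P p (fun ω => X ω + ξ ω * Y ω)
      ≤ sqMoment P p X + ENNReal.ofReal ((4 * p + 1) * μ ^ 2) * sqMoment P p Y := by
  have hp0 : (p : ENNReal) ≠ 0 := by exact_mod_cast (by omega : p ≠ 0)
  have hpt : (p : ENNReal) ≠ ⊤ := ENNReal.natCast_ne_top p
  set κ : ℝ := (4 * p + 1) * μ ^ 2 with hκ
  have hκ0 : 0 ≤ κ := by positivity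
  have hXY : Measurable fun ω => (X ω, Y ω) := hX.prodMk hY
  have hlint : ∫⁻ ω, ENNReal.ofReal (‖X ω + ξ ω * Y ω‖ ^ (2 * p)) ∂P
      ≤ ∫⁻ ω, ENNReal.ofReal ((‖X ω‖ ^ 2 + κ * ‖Y ω‖ ^ 2) ^ p) ∂P := by
    have hF : Measurable fun q : (ℂ × ℂ) × ℂ =>
        ENNReal.ofReal (‖q.1.1 + q.2 * q.1.2‖ ^ (2 * p)) := by fun_prop
    have hmap := (indepFun_iff_map_prod_eq_prod_map_map hXY.aemeasurable hξ.aemeasurable).mp hind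
    have e1 := lintegral_map hF (hXY.prodMk hξ) (μ := P)
    simp only at e1
    rw [← e1, hmap, lintegral_prod _ hF.aemeasurable, lintegral_map hF.lintegral_prod_right' hXY]
    refine lintegral_mono fun ω => ?_
    simp only
    rw [lintegral_map (by fun_prop) hξ]
    exact lintegral_norm_add_mul_pow_le hξ h0 hp hμ hmom (X ω) (Y ω)
  have hstep : sqMoment P p (fun ω => X ω + ξ ω * Y ω)
      ≤ eLpNorm (fun ω => ‖X ω‖ ^ 2 + κ * ‖Y ω‖ ^ 2) p P := by
    rw [sqMoment, eLpNorm_eq_lintegral_rpow_enorm_toReal hp0 hpt,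
      eLpNorm_eq_lintegral_rpow_enorm_toReal hp0 hpt]
    refine ENNReal.rpow_le_rpow ?_ (by positivity)
    simp only [ENNReal.toReal_natCast, ENNReal.rpow_natCast]
    refine le_trans (le_of_eq ?_) (hlint.trans (le_of_eq ?_))
    · refine lintegral_congr fun ω => ?_
      rw [Real.enorm_eq_ofReal (by positivity), ← ENNReal.ofReal_pow (by positivity), pow_mul]
    · refine lintegral_congr fun ω => ?_
      rw [Real.enorm_eq_ofReal (by positivity), ← ENNReal.ofReal_pow (by positivity)]
  refine hstep.trans ?_
  have h1 : AEStronglyMeasurable (fun ω => ‖X ω‖ ^ 2) P := by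
    exact (hX.norm.pow_const 2).aestronglyMeasurable
  have h2 : AEStronglyMeasurable (fun ω => κ * ‖Y ω‖ ^ 2) P := by
    exact ((hY.norm.pow_const 2).const_mul κ).aestronglyMeasurable
  have h3 := eLpNorm_add_le h1 h2 (p := p) (by exact_mod_cast hp)
  refine h3.trans (add_le_add le_rfl ?_)
  have h4 := eLpNorm_const_smul κ (fun ω => ‖Y ω‖ ^ 2) (p : ENNReal) P
  rw [Real.enorm_eq_ofReal hκ0] at h4
  exact h4.le

end Hypercontractivity

/-! ### Moments and tails of linear and quadratic forms. -/

section Forms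

variable {Ω : Type*} [MeasurableSpace Ω] {P : Measure Ω}

theorem indepFun_comp_restrict {ι β : Type*} [MeasurableSpace β] {b : ι → Ω → ℂ}
    (hind : iIndepFun b P) (hb : ∀ k, Measurable (b k)) {S : Finset ι} {m : ι} (hm : m ∉ S)
    {F : (S → ℂ) → β} (hF : Measurable F) :
    IndepFun (fun ω => F fun k => b k ω) (b m) P := by
  have h := hind.indepFun_finset S {m} (Finset.disjoint_singleton_right.mpr hm) hb
  exact h.comp hF (measurable_pi_apply (⟨m, Finset.mem_singleton_self m⟩ : ({m} : Finset ι)))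

theorem sqMoment_zero {p : ℕ} : sqMoment P p (fun _ => 0) = 0 := by
  simp [sqMoment]

theorem sqMoment_const [IsProbabilityMeasure P] {p : ℕ} (hp : 1 ≤ p) (c : ℂ) :
    sqMoment P p (fun _ => c) = ENNReal.ofReal (‖c‖ ^ 2) := by
  have hp0 : (p : ENNReal) ≠ 0 := by exact_mod_cast (by omega : p ≠ 0)
  rw [sqMoment, eLpNorm_const _ hp0 (IsProbabilityMeasure.ne_zero P), measure_univ,
    ENNReal.one_rpow, mul_one, Real.enorm_eq_ofReal (by positivity)]

theorem sqMoment_congr_norm {p : ℕ} {X Y : Ω → ℂ} (h : ∀ ω, ‖X ω‖ = ‖Y ω‖) :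
    sqMoment P p X = sqMoment P p Y := by
  simp_rw [sqMoment, h]

/-- Moments of linear forms in independent centred variables. -/
theorem sqMoment_linear_le [IsProbabilityMeasure P] {ι : Type*} {b : ι → Ω → ℂ} (hb : ∀ k, Measurable (b k))
    (hind : iIndepFun b P) (h0 : ∀ k, ∫ ω, b k ω ∂P = 0) {p : ℕ} (hp : 1 ≤ p) {μ : ℝ} (hμ : 0 ≤ μ)
    (hmom : ∀ k, HasMomentBound P (b k) (2 * p) μ) (c : ι → ℂ) (S : Finset ι) :
    sqMoment P p (fun ω => ∑ k ∈ S, c k * b k ω)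
      ≤ ENNReal.ofReal ((4 * p + 1) * μ ^ 2 * ∑ k ∈ S, ‖c k‖ ^ 2) := by
  classical
  induction S using Finset.induction_on with
  | empty => simp [sqMoment_zero]
  | insert m S hm ih =>
    have hX : Measurable fun ω => ∑ k ∈ S, c k * b k ω :=
      Finset.measurable_sum _ fun k _ => (hb k).const_mul _
    have hi : IndepFun (fun ω => ((∑ k ∈ S, c k * b k ω), c m)) (b m) P := by
      have := indepFun_comp_restrict hind hb hm
        (F := fun v : S → ℂ => ((∑ k : S, c k * v k), c m)) (by fun_prop)
      convert this using 3 with ω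
      exact (Finset.sum_coe_sort S fun k => c k * b k ω).symm
    have h := sqMoment_add_mul_le (hb m) hX measurable_const hi (h0 m) hp hμ (hmom m)
    have e : (fun ω => ∑ k ∈ insert m S, c k * b k ω)
        = fun ω => (∑ k ∈ S, c k * b k ω) + b m ω * c m := by
      funext ω; rw [Finset.sum_insert hm]; ring
    rw [e, Finset.sum_insert hm, mul_add, ENNReal.ofReal_add (by positivity) (by positivity),
      add_comm (ENNReal.ofReal _)]
    refine h.trans (add_le_add ih ?_)
    rw [sqMoment_const hp, ← ENNReal.ofReal_mul (by positivity)]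

/-- Moments of strictly triangular quadratic forms in independent centred variables. -/
theorem sqMoment_triangular_le [IsProbabilityMeasure P] {ι : Type*} [LinearOrder ι] {b : ι → Ω → ℂ}
    (hb : ∀ k, Measurable (b k)) (hind : iIndepFun b P) (h0 : ∀ k, ∫ ω, b k ω ∂P = 0) {p : ℕ}
    (hp : 1 ≤ p) {μ : ℝ} (hμ : 0 ≤ μ) (hmom : ∀ k, HasMomentBound P (b k) (2 * p) μ)
    (B : ι → ι → ℂ) (hB : ∀ k l, ¬ k < l → B k l = 0) (S : Finset ι) :
    sqMoment P p (fun ω => ∑ k ∈ S, ∑ l ∈ S, star (b k ω) * B k l * b l ω)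
      ≤ ENNReal.ofReal (((4 * p + 1) * μ ^ 2) ^ 2 * ∑ k ∈ S, ∑ l ∈ S, ‖B k l‖ ^ 2) := by
  -- Adding the largest index `m` contributes only `b m` times a linear form in the earlier
  -- variables, since row `m` of `B` vanishes on the index set. This one step and the linear form
  -- each cost a factor `κ`.
  induction S using Finset.induction_on_max with
  | empty => simp [sqMoment_zero]
  | insert m S hlt ih =>
    have hm : m ∉ S := fun h => lt_irrefl m (hlt m h)
    set κ : ℝ := (4 * p + 1) * μ ^ 2 with hκ
    have hκ0 : 0 ≤ κ := by positivity
    have hX : Measurable fun ω => ∑ k ∈ S, ∑ l ∈ S, star (b k ω) * B k l * b l ω :=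
      Finset.measurable_sum _ fun k _ => Finset.measurable_sum _ fun l _ =>
        (((continuous_star.measurable.comp (hb k))).mul_const _).mul (hb l)
    have hY : Measurable fun ω => ∑ k ∈ S, star (b k ω) * B k m :=
      Finset.measurable_sum _ fun k _ => (continuous_star.measurable.comp (hb k)).mul_const _
    have hi : IndepFun (fun ω => ((∑ k ∈ S, ∑ l ∈ S, star (b k ω) * B k l * b l ω),
        ∑ k ∈ S, star (b k ω) * B k m)) (b m) P := by
      have := indepFun_comp_restrict hind hb hm
        (F := fun v : S → ℂ => ((∑ k : S, ∑ l : S, star (v k) * B k l * v l),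
          ∑ k : S, star (v k) * B k m))
        (Continuous.measurable (by fun_prop))
      convert this using 3 with ω
      · rw [← Finset.sum_coe_sort S]
        exact Finset.sum_congr rfl fun k _ =>
          (Finset.sum_coe_sort S fun l => star (b k ω) * B k l * b l ω).symm
      · exact (Finset.sum_coe_sort S fun k => star (b k ω) * B k m).symm
    have h := sqMoment_add_mul_le (hb m) hX hY hi (h0 m) hp hμ (hmom m)
    have hrow : ∀ l ∈ insert m S, B m l = 0 := fun l hl => hB _ _ (by
      rcases Finset.mem_insert.mp hl with rfl | hl
      · exact lt_irrefl _
      · exact not_lt.mpr (hlt l hl).le)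
    have e : (fun ω => ∑ k ∈ insert m S, ∑ l ∈ insert m S, star (b k ω) * B k l * b l ω)
        = fun ω => (∑ k ∈ S, ∑ l ∈ S, star (b k ω) * B k l * b l ω)
          + b m ω * ∑ k ∈ S, star (b k ω) * B k m := by
      funext ω
      rw [Finset.sum_insert hm, Finset.sum_eq_zero (fun l hl => by rw [hrow l hl]; ring), zero_add,
        Finset.mul_sum, ← Finset.sum_add_distrib]
      refine Finset.sum_congr rfl fun k _ => ?_
      rw [Finset.sum_insert hm]; ring
    have e2 : ∑ k ∈ insert m S, ∑ l ∈ insert m S, ‖B k l‖ ^ 2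
        = ∑ k ∈ S, ∑ l ∈ S, ‖B k l‖ ^ 2 + ∑ k ∈ S, ‖B k m‖ ^ 2 := by
      rw [Finset.sum_insert hm, Finset.sum_eq_zero (fun l hl => by rw [hrow l hl]; simp), zero_add,
        ← Finset.sum_add_distrib]
      refine Finset.sum_congr rfl fun k _ => ?_
      rw [Finset.sum_insert hm]; ring
    rw [e, e2, mul_add, ENNReal.ofReal_add (by positivity) (by positivity)]
    refine h.trans (add_le_add ih ?_)
    have hlin := sqMoment_linear_le hb hind h0 hp hμ hmom (fun k => star (B k m)) S
    have hconj : sqMoment P p (fun ω => ∑ k ∈ S, star (b k ω) * B k m)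
        = sqMoment P p (fun ω => ∑ k ∈ S, star (B k m) * b k ω) := by
      refine sqMoment_congr_norm fun ω => ?_
      rw [← norm_star, star_sum]
      simp only [star_mul', star_star, mul_comm]
    rw [hconj]
    simp only [norm_star] at hlin
    calc _ ≤ ENNReal.ofReal κ * ENNReal.ofReal (κ * ∑ k ∈ S, ‖B k m‖ ^ 2) := by gcongr
      _ = _ := by rw [← ENNReal.ofReal_mul hκ0]; congr 1; ring

/-- Markov's inequality at the scale of the `L^(2p)` norm. -/
theorem measure_lt_norm_le_of_sqMoment_le {X : Ω → ℂ} (hX : Measurable X) {p : ℕ} (hp : 1 ≤ p)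
    {v : ℝ} (hv : 0 ≤ v) (h : sqMoment P p X ≤ ENNReal.ofReal (v ^ 2)) :
    P {ω | Real.exp 1 * v < ‖X ω‖} ≤ ENNReal.ofReal (Real.exp (-(2 * p))) := by
  have hp0 : (p : ENNReal) ≠ 0 := by exact_mod_cast (by omega : p ≠ 0)
  have hpt : (p : ENNReal) ≠ ⊤ := ENNReal.natCast_ne_top p
  have hmeas : AEStronglyMeasurable (fun ω => ‖X ω‖ ^ 2) P := by
    exact (hX.norm.pow_const 2).aestronglyMeasurable
  rcases hv.eq_or_lt with rfl | hv
  · have hz : eLpNorm (fun ω => ‖X ω‖ ^ 2) p P = 0 := by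
      have : sqMoment P p X ≤ 0 := by simpa using h
      exact le_antisymm this bot_le
    rw [eLpNorm_eq_zero_iff hmeas hp0] at hz
    have : P {ω | Real.exp 1 * 0 < ‖X ω‖} = 0 := by
      refine measure_mono_null (fun ω hω => ?_) hz
      simp only [mul_zero, Set.mem_ofPred_eq] at hω
      simpa using norm_pos_iff.mp hω
    rw [this]; exact bot_le
  · have hε : ENNReal.ofReal ((Real.exp 1 * v) ^ 2) ≠ 0 := by
      rw [Ne, ENNReal.ofReal_eq_zero, not_le]; positivity
    have hM := meas_ge_le_mul_pow_eLpNorm_enorm P hp0 hpt hmeas hε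
      (fun h => absurd h ENNReal.ofReal_ne_top)
    rw [ENNReal.toReal_natCast, ENNReal.rpow_natCast, ENNReal.rpow_natCast] at hM
    calc P {ω | Real.exp 1 * v < ‖X ω‖}
        ≤ P {ω | ENNReal.ofReal ((Real.exp 1 * v) ^ 2) ≤ ‖(‖X ω‖ ^ 2 : ℝ)‖ₑ} := by
          refine measure_mono fun ω hω => ?_
          simp only [Set.mem_ofPred_eq] at hω ⊢
          rw [Real.enorm_eq_ofReal (by positivity)]
          exact ENNReal.ofReal_le_ofReal (pow_le_pow_left₀ (by positivity) hω.le 2)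
      _ ≤ (ENNReal.ofReal ((Real.exp 1 * v) ^ 2))⁻¹ ^ p * ENNReal.ofReal (v ^ 2) ^ p := by
          refine hM.trans ?_
          gcongr
          exact h
      _ = _ := by
          rw [← ENNReal.ofReal_inv_of_pos (by positivity), ← ENNReal.ofReal_pow (by positivity),
            ← ENNReal.ofReal_pow (by positivity), ← ENNReal.ofReal_mul (by positivity), ← mul_pow]
          congr 1
          have : ((Real.exp 1 * v) ^ 2)⁻¹ * v ^ 2 = Real.exp (-2) := by
            rw [Real.exp_neg, show (2 : ℝ) = 1 + 1 by norm_num, Real.exp_add]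
            field_simp
          rw [this, ← Real.exp_nat_mul]
          congr 1; ring

/-- Dominate by `(|ξ|² + 1)^j`, expand, bound each even moment and resum. -/
theorem HasMomentBound.norm_sq_sub_one {ξ : Ω → ℂ} (hξ : Measurable ξ) {q : ℕ} {μ : ℝ}
    (h : HasMomentBound P ξ (2 * q) μ) :
    HasMomentBound P (fun ω => ((‖ξ ω‖ ^ 2 - 1 : ℝ) : ℂ)) q (μ ^ 2 + 1) := by
  intro j hj
  have hexpand : ∀ x : ℝ, (x ^ 2 + 1) ^ j
      = ∑ i ∈ Finset.range (j + 1), x ^ (2 * i) * (j.choose i : ℝ) := fun x => by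
    rw [add_pow]; exact Finset.sum_congr rfl fun i _ => by rw [one_pow, mul_one, pow_mul]
  have hle : ∀ i ∈ Finset.range (j + 1), 2 * i ≤ 2 * q := fun i hi => by
    have := Finset.mem_range.mp hi; omega
  have hint : Integrable (fun ω => (‖ξ ω‖ ^ 2 + 1) ^ j) P := by
    simp_rw [hexpand]
    exact integrable_finsetSum _ fun i hi => (h _ (hle i hi)).1.mul_const _
  have hpw : ∀ ω, ‖((‖ξ ω‖ ^ 2 - 1 : ℝ) : ℂ)‖ ^ j ≤ (‖ξ ω‖ ^ 2 + 1) ^ j := fun ω => by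
    rw [Complex.norm_real, Real.norm_eq_abs]
    refine pow_le_pow_left₀ (abs_nonneg _) ?_ j
    rw [abs_le]; constructor <;> nlinarith [sq_nonneg ‖ξ ω‖]
  have hint2 : Integrable (fun ω => ‖((‖ξ ω‖ ^ 2 - 1 : ℝ) : ℂ)‖ ^ j) P := by
    refine hint.mono' (Measurable.aestronglyMeasurable (by fun_prop)) (Eventually.of_forall fun ω => ?_)
    rw [Real.norm_of_nonneg (by positivity)]
    exact hpw ω
  refine ⟨hint2, (integral_mono hint2 hint hpw).trans ?_⟩
  simp_rw [hexpand]
  rw [integral_finsetSum _ fun i hi => (h _ (hle i hi)).1.mul_const _]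
  refine Finset.sum_le_sum fun i hi => ?_
  rw [integral_mul_const]
  exact mul_le_mul_of_nonneg_right (h _ (hle i hi)).2 (by positivity)

theorem HasMomentBound.mono {ξ : Ω → ℂ} {q q' : ℕ} {μ : ℝ} (h : HasMomentBound P ξ q μ)
    (hq : q' ≤ q) : HasMomentBound P ξ q' μ := fun j hj => h j (hj.trans hq)

/-- Concentration of quadratic forms in independent centred variables of unit variance. -/
theorem measure_quadratic_form_le [IsProbabilityMeasure P] {ι : Type*} [LinearOrder ι] {b : ι → Ω → ℂ}
    (hb : ∀ k, Measurable (b k)) (hind : iIndepFun b P) (h0 : ∀ k, ∫ ω, b k ω ∂P = 0) {p : ℕ}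
    (hp : 1 ≤ p) {μ : ℝ} (hμ : 0 ≤ μ) (hmom : ∀ k, HasMomentBound P (b k) (4 * p) μ)
    (S : Finset ι) (hvar : ∀ k ∈ S, ∫ ω, ‖b k ω‖ ^ 2 ∂P = 1) (A : ι → ι → ℂ) :
    P {ω | 3 * Real.exp 1 * ((4 * p + 1) * (μ ^ 2 + 1)) * √(∑ k ∈ S, ∑ l ∈ S, ‖A k l‖ ^ 2)
        < ‖∑ k ∈ S, ∑ l ∈ S, star (b k ω) * A k l * b l ω - ∑ k ∈ S, A k k‖}
      ≤ 3 * ENNReal.ofReal (Real.exp (-(2 * p))) := by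
  set V := ∑ k ∈ S, ∑ l ∈ S, ‖A k l‖ ^ 2 with hV
  have hV0 : 0 ≤ V := by positivity
  set K : ℝ := (4 * p + 1) * (μ ^ 2 + 1) with hK
  have hp' : (1 : ℝ) ≤ p := by exact_mod_cast hp
  have hmom2 : ∀ k, HasMomentBound P (b k) (2 * p) μ := fun k => (hmom k).mono (by omega)
  set L : ι → ι → ℂ := fun k l => if k < l then A k l else 0 with hL
  -- The part of `A` below the diagonal is conjugate transposed, so that both off-diagonal parts are
  -- strictly upper triangular.
  set U : ι → ι → ℂ := fun k l => if k < l then star (A l k) else 0 with hU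
  set d : ι → Ω → ℂ := fun k ω => ((‖b k ω‖ ^ 2 - 1 : ℝ) : ℂ) with hd
  set QL : Ω → ℂ := fun ω => ∑ k ∈ S, ∑ l ∈ S, star (b k ω) * L k l * b l ω with hQL
  set QU : Ω → ℂ := fun ω => ∑ k ∈ S, ∑ l ∈ S, star (b k ω) * U k l * b l ω with hQU
  set QD : Ω → ℂ := fun ω => ∑ k ∈ S, A k k * d k ω with hQD
  have hstar : ∀ k, Measurable fun ω => star (b k ω) := fun k =>
    continuous_star.measurable.comp (hb k)
  have hquad : ∀ B : ι → ι → ℂ,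
      Measurable fun ω => ∑ k ∈ S, ∑ l ∈ S, star (b k ω) * B k l * b l ω := fun B =>
    Finset.measurable_sum _ fun k _ => Finset.measurable_sum _ fun l _ =>
      ((hstar k).mul_const _).mul (hb l)
  have hdm : ∀ k, Measurable (d k) := fun k => by
    have := hb k
    simp only [hd]; fun_prop
  have hpair : ∀ k l, ‖L k l‖ ^ 2 ≤ ‖A k l‖ ^ 2 ∧ ‖U k l‖ ^ 2 ≤ ‖A l k‖ ^ 2 := by
    intro k l
    simp only [hL, hU]
    split_ifs <;> simp
  have hdecomp : ∀ ω, ∑ k ∈ S, ∑ l ∈ S, star (b k ω) * A k l * b l ω - ∑ k ∈ S, A k k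
      = QL ω + star (QU ω) + QD ω := by
    intro ω
    have e1 : star (QU ω) = ∑ k ∈ S, ∑ l ∈ S, star (b k ω) * (if l < k then A k l else 0) * b l ω := by
      simp only [hQU, star_sum]
      rw [Finset.sum_comm]
      refine Finset.sum_congr rfl fun k _ => Finset.sum_congr rfl fun l _ => ?_
      simp only [hU, star_mul', star_star]
      split_ifs
      · rw [star_star]; ring
      · simp
    have e2 : QD ω = ∑ k ∈ S, ∑ l ∈ S, star (b k ω) * (if k = l then A k l else 0) * b l ω
        - ∑ k ∈ S, A k k := by
      simp only [hQD, ← Finset.sum_sub_distrib]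
      refine Finset.sum_congr rfl fun k hk => ?_
      rw [Finset.sum_eq_single k (fun l _ hl => by rw [if_neg (Ne.symm hl)]; ring)
        (fun h => absurd hk h), if_pos rfl]
      have : (‖b k ω‖ ^ 2 : ℂ) = star (b k ω) * b k ω := by
        rw [RCLike.star_def, Complex.conj_mul']
      simp only [hd]
      push_cast
      rw [this]; ring
    rw [e1, e2]
    simp only [hQL]
    rw [← add_sub_assoc, ← Finset.sum_add_distrib, ← Finset.sum_add_distrib]
    congr 1
    refine Finset.sum_congr rfl fun k _ => ?_
    rw [← Finset.sum_add_distrib, ← Finset.sum_add_distrib]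
    refine Finset.sum_congr rfl fun l _ => ?_
    simp only [hL]
    rcases lt_trichotomy k l with h | h | h
    · simp [h, h.ne, h.not_gt]
    · simp [h]
    · simp [h, h.ne', h.not_gt]
  have hKV : (K * √V) ^ 2 = K ^ 2 * V := by rw [mul_pow, Real.sq_sqrt hV0]
  have hκK : ((4 * p + 1) * μ ^ 2) ^ 2 ≤ K ^ 2 :=
    pow_le_pow_left₀ (by positivity) (by rw [hK]; gcongr; linarith) 2
  have hL' : P {ω | Real.exp 1 * (K * √V) < ‖QL ω‖} ≤ ENNReal.ofReal (Real.exp (-(2 * p))) := by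
    refine measure_lt_norm_le_of_sqMoment_le (hquad L) hp (by positivity) ?_
    refine (sqMoment_triangular_le hb hind h0 hp hμ hmom2 L
      (fun k l hkl => if_neg hkl) S).trans (ENNReal.ofReal_le_ofReal ?_)
    rw [hKV]
    gcongr
    exact Finset.sum_le_sum fun k _ => Finset.sum_le_sum fun l _ => (hpair k l).1
  have hU' : P {ω | Real.exp 1 * (K * √V) < ‖QU ω‖} ≤ ENNReal.ofReal (Real.exp (-(2 * p))) := by
    refine measure_lt_norm_le_of_sqMoment_le (hquad U) hp (by positivity) ?_
    refine (sqMoment_triangular_le hb hind h0 hp hμ hmom2 U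
      (fun k l hkl => if_neg hkl) S).trans (ENNReal.ofReal_le_ofReal ?_)
    rw [hKV]
    gcongr
    rw [hV, Finset.sum_comm (f := fun k l => ‖A k l‖ ^ 2)]
    exact Finset.sum_le_sum fun k _ => Finset.sum_le_sum fun l _ => (hpair k l).2
  have hD' : P {ω | Real.exp 1 * (K * √V) < ‖QD ω‖} ≤ ENNReal.ofReal (Real.exp (-(2 * p))) := by
    refine measure_lt_norm_le_of_sqMoment_le
      (Finset.measurable_sum _ fun k _ => (hdm k).const_mul _) hp (by positivity) ?_
    -- The family is indexed by `S` because `|b k|² - 1` is known to be centred only there. Its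
    -- moments up to order `2p` require those of `b k` up to `4p`.
    have hdind : iIndepFun (fun k : S => d k) P :=
      (hind.precomp Subtype.val_injective).comp (fun _ x => ((‖x‖ ^ 2 - 1 : ℝ) : ℂ))
        (fun _ => by fun_prop)
    have hd0 : ∀ k : S, ∫ ω, d k ω ∂P = 0 := by
      intro k
      simp only [hd]
      rw [integral_complex_ofReal, integral_sub ((hmom k 2 (by omega)).1) (integrable_const _),
        hvar k k.2]
      simp
    have hQS : QD = fun ω => ∑ k ∈ S.attach, A k k * d k ω := by
      funext ω
      exact (Finset.sum_attach S fun k => A k k * d k ω).symm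
    change sqMoment P p QD ≤ _
    rw [hQS]
    refine (sqMoment_linear_le (b := fun k : S => d k) (fun k => hdm k) hdind hd0 hp
      (μ := μ ^ 2 + 1) (by positivity)
      (fun k => HasMomentBound.norm_sq_sub_one (hb k) ((hmom k).mono (by omega)))
      (fun k => A k k) S.attach).trans (ENNReal.ofReal_le_ofReal ?_)
    rw [hKV, Finset.sum_attach S fun k => ‖A k k‖ ^ 2, hK, mul_pow]
    have h1 : ∑ k ∈ S, ‖A k k‖ ^ 2 ≤ V := Finset.sum_le_sum fun k hk =>
      Finset.single_le_sum (f := fun l => ‖A k l‖ ^ 2) (fun _ _ => by positivity) hk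
    gcongr
    nlinarith
  have hsub : {ω | 3 * Real.exp 1 * K * √V
      < ‖∑ k ∈ S, ∑ l ∈ S, star (b k ω) * A k l * b l ω - ∑ k ∈ S, A k k‖}
      ⊆ ({ω | Real.exp 1 * (K * √V) < ‖QL ω‖} ∪ {ω | Real.exp 1 * (K * √V) < ‖QU ω‖})
        ∪ {ω | Real.exp 1 * (K * √V) < ‖QD ω‖} := by
    intro ω hω
    simp only [Set.mem_ofPred_eq, Set.mem_union] at hω ⊢
    by_contra hcon
    push Not at hcon
    obtain ⟨⟨c1, c2⟩, c3⟩ := hcon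
    rw [hdecomp] at hω
    have t1 := norm_add_le (QL ω + star (QU ω)) (QD ω)
    have t2 := norm_add_le (QL ω) (star (QU ω))
    rw [norm_star] at t2
    nlinarith
  calc _ ≤ _ := measure_mono hsub
    _ ≤ ENNReal.ofReal (Real.exp (-(2 * p))) + ENNReal.ofReal (Real.exp (-(2 * p)))
        + ENNReal.ofReal (Real.exp (-(2 * p))) :=
      (measure_union_le _ _).trans (add_le_add ((measure_union_le _ _).trans
        (add_le_add hL' hU')) hD')
    _ = _ := by ring

end Forms

/-! ### From stretched exponential tails to moments. -/

section Moments

variable {Ω : Type*} [MeasurableSpace Ω] {P : Measure Ω} [IsProbabilityMeasure P]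

/-- The value `e^(U/2)` is at most the term `k = ⌊U⌋` of a sum of indicators of `{k ≤ U}`. The tail
bound `e^(T₀ - k)` is trivial for `k ≤ T₀`, so the expectations form a geometric series. -/
theorem lintegral_exp_half_le {U : Ω → ℝ} (hU : Measurable U) (hU0 : ∀ ω, 0 ≤ U ω)
    {T₀ : ℝ} (hT₀ : 0 ≤ T₀) (htail : ∀ t, T₀ ≤ t → P.real {ω | t ≤ U ω} ≤ Real.exp (-t)) :
    ∫⁻ ω, ENNReal.ofReal (Real.exp (U ω / 2)) ∂P
      ≤ ENNReal.ofReal (Real.exp (T₀ + 1 / 2) * (1 - Real.exp (-1 / 2))⁻¹) := by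
  have htail' : ∀ k : ℕ, P {ω | (k : ℝ) ≤ U ω} ≤ ENNReal.ofReal (Real.exp (T₀ - k)) := by
    intro k
    rw [← ofReal_measureReal]
    refine ENNReal.ofReal_le_ofReal ?_
    rcases le_total T₀ (k : ℝ) with h | h
    · exact (htail k h).trans (Real.exp_le_exp.mpr (by linarith))
    · exact measureReal_le_one.trans (Real.one_le_exp (by linarith))
  have hpt : ∀ ω, ENNReal.ofReal (Real.exp (U ω / 2)) ≤ ∑' k : ℕ,
      {ω | (k : ℝ) ≤ U ω}.indicator (fun _ => ENNReal.ofReal (Real.exp ((k + 1) / 2))) ω := by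
    intro ω
    refine le_trans ?_ (ENNReal.le_tsum ⌊U ω⌋₊)
    rw [Set.indicator_of_mem (by exact Nat.floor_le (hU0 ω))]
    refine ENNReal.ofReal_le_ofReal (Real.exp_le_exp.mpr ?_)
    have := Nat.lt_floor_add_one (U ω)
    linarith
  have hms : ∀ k : ℕ, MeasurableSet {ω | (k : ℝ) ≤ U ω} := fun k =>
    measurableSet_le measurable_const hU
  have hq0 : 0 ≤ Real.exp (-1 / 2) := (Real.exp_pos _).le
  have hq1 : Real.exp (-1 / 2) < 1 := Real.exp_lt_one_iff.mpr (by norm_num)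
  calc _ ≤ ∫⁻ ω, ∑' k : ℕ, {ω | (k : ℝ) ≤ U ω}.indicator
        (fun _ => ENNReal.ofReal (Real.exp ((k + 1) / 2))) ω ∂P := lintegral_mono hpt
    _ = ∑' k : ℕ, ENNReal.ofReal (Real.exp ((k + 1) / 2)) * P {ω | (k : ℝ) ≤ U ω} := by
        rw [lintegral_tsum fun k => (measurable_const.indicator (hms k)).aemeasurable]
        exact tsum_congr fun k => lintegral_indicator_const (hms k) _
    _ ≤ ∑' k : ℕ, ENNReal.ofReal (Real.exp (T₀ + 1 / 2) * Real.exp (-1 / 2) ^ k) := by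
        refine ENNReal.tsum_le_tsum fun k => ?_
        refine (mul_le_mul_right (htail' k) _).trans_eq ?_
        rw [← ENNReal.ofReal_mul (by positivity), ← Real.exp_add, ← Real.exp_nat_mul,
          ← Real.exp_add]
        congr 2; ring
    _ = _ := by
        rw [← ENNReal.ofReal_tsum_of_nonneg (fun k => by positivity)
          ((summable_geometric_of_lt_one hq0 hq1).mul_left _), tsum_mul_left,
          tsum_geometric_of_lt_one hq0 hq1]

/-- Stretched exponential tails bound the moments. -/
theorem hasMomentBound_of_tail {ξ : Ω → ℂ} (hξ : Measurable ξ) {D : ℕ} (hD : 1 ≤ D) {T₀ : ℝ}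
    (hT₀ : 0 ≤ T₀) (htail : ∀ t, T₀ ≤ t → P.real {ω | t ^ D ≤ ‖ξ ω‖} ≤ Real.exp (-t)) (q : ℕ) :
    HasMomentBound P ξ q
      ((2 * D * (Real.exp (T₀ + 1 / 2) * (1 - Real.exp (-1 / 2))⁻¹) * q) ^ D) := by
  set M := Real.exp (T₀ + 1 / 2) * (1 - Real.exp (-1 / 2))⁻¹ with hM
  have hq0 : 0 < Real.exp (-1 / 2) := Real.exp_pos _
  have hq1 : Real.exp (-1 / 2) < 1 := Real.exp_lt_one_iff.mpr (by norm_num)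
  have hM1 : 1 ≤ M := one_le_mul_of_one_le_of_one_le (Real.one_le_exp (by linarith))
    ((one_le_inv₀ (by linarith)).mpr (by linarith))
  set U : Ω → ℝ := fun ω => ‖ξ ω‖ ^ ((D : ℝ)⁻¹) with hU
  have hUm : Measurable U := hξ.norm.pow_const _
  have hU0 : ∀ ω, 0 ≤ U ω := fun ω => by positivity
  have hUD : ∀ ω, U ω ^ D = ‖ξ ω‖ := fun ω =>
    Real.rpow_inv_natCast_pow (norm_nonneg _) (by omega)
  have hexp := lintegral_exp_half_le (P := P) hUm hU0 hT₀ fun t ht =>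
    (measureReal_mono (fun ω (hω : t ≤ U ω) => by
      change t ^ D ≤ ‖ξ ω‖
      rw [← hUD]; exact pow_le_pow_left₀ (hT₀.trans ht) hω D)).trans (htail t ht)
  rw [← hM] at hexp
  intro j hj
  rcases Nat.eq_zero_or_pos j with rfl | hj0
  · simp
  set m := D * j with hm
  have hm1 : 1 ≤ m := Nat.mul_pos hD hj0
  -- `|ξ|^j = U^m`, and `x^m / m! ≤ e^x` at `x = U/2`.
  have hpw : ∀ ω, ‖ξ ω‖ ^ j ≤ (2 ^ m * m.factorial) * Real.exp (U ω / 2) := by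
    intro ω
    have h := Real.pow_div_factorial_le_exp (U ω / 2) (by have := hU0 ω; positivity) m
    rw [div_le_iff₀ (by positivity), div_pow, div_le_iff₀ (by positivity)] at h
    rw [← hUD, ← pow_mul, ← hm]
    linarith
  have hlin : ∫⁻ ω, ENNReal.ofReal (‖ξ ω‖ ^ j) ∂P ≤ ENNReal.ofReal ((2 ^ m * m.factorial) * M) := by
    calc _ ≤ ∫⁻ ω, ENNReal.ofReal (2 ^ m * m.factorial)
            * ENNReal.ofReal (Real.exp (U ω / 2)) ∂P := by
          refine lintegral_mono fun ω => ?_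
          rw [← ENNReal.ofReal_mul (by positivity)]
          exact ENNReal.ofReal_le_ofReal (hpw ω)
      _ = ENNReal.ofReal (2 ^ m * m.factorial)
            * ∫⁻ ω, ENNReal.ofReal (Real.exp (U ω / 2)) ∂P :=
          lintegral_const_mul _ (by fun_prop)
      _ ≤ ENNReal.ofReal (2 ^ m * m.factorial) * ENNReal.ofReal M := by gcongr
      _ = _ := (ENNReal.ofReal_mul (by positivity)).symm
  have hmeas : AEStronglyMeasurable (fun ω => ‖ξ ω‖ ^ j) P := by
    exact (hξ.norm.pow_const j).aestronglyMeasurable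
  have hnn : 0 ≤ᵐ[P] fun ω => ‖ξ ω‖ ^ j := Eventually.of_forall fun ω => by positivity
  have hint : Integrable (fun ω => ‖ξ ω‖ ^ j) P :=
    (lintegral_ofReal_ne_top_iff_integrable hmeas hnn).mp (hlin.trans_lt ENNReal.ofReal_lt_top).ne
  refine ⟨hint, ?_⟩
  rw [← ofReal_integral_eq_lintegral_ofReal hint hnn,
    ENNReal.ofReal_le_ofReal_iff (by positivity)] at hlin
  refine hlin.trans ?_
  have hfac : (m.factorial : ℝ) ≤ (m : ℝ) ^ m := by exact_mod_cast Nat.factorial_le_pow m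
  have hMm : M ≤ M ^ m := le_self_pow₀ hM1 (by omega)
  have hjq : (j : ℝ) ≤ q := by exact_mod_cast hj
  calc 2 ^ m * (m.factorial : ℝ) * M ≤ 2 ^ m * (m : ℝ) ^ m * M ^ m := by gcongr
    _ = (2 * (D * j) * M) ^ m := by rw [← mul_pow, ← mul_pow, hm]; push_cast; rfl
    _ ≤ (2 * (D * q) * M) ^ m := by gcongr
    _ = _ := by rw [hm, pow_mul]; ring_nf

end Moments

/-! ### Independence of columns and minors, and concentration at one spectral parameter. -/

section Concentration

variable {Ω : Type*} [MeasurableSpace Ω] {P : Measure Ω}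

/-- Conditioning on an independent variable. -/
theorem IndepFun.measure_prodMk_mem_le [IsProbabilityMeasure P] {α β : Type*} [MeasurableSpace α] [MeasurableSpace β]
    {X : Ω → α} {Y : Ω → β} (hX : Measurable X) (hY : Measurable Y) (h : IndepFun X Y P)
    {E : Set (α × β)} (hE : MeasurableSet E) {ε : ENNReal}
    (hε : ∀ y, P {ω | (X ω, y) ∈ E} ≤ ε) : P {ω | (X ω, Y ω) ∈ E} ≤ ε := by
  have hmap := (indepFun_iff_map_prod_eq_prod_map_map hX.aemeasurable hY.aemeasurable).mp h
  have e1 : P {ω | (X ω, Y ω) ∈ E} = (P.map fun ω => (X ω, Y ω)) E :=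
    (Measure.map_apply (hX.prodMk hY) hE).symm
  have := Measure.isProbabilityMeasure_map hX.aemeasurable (μ := P)
  have := Measure.isProbabilityMeasure_map hY.aemeasurable (μ := P)
  rw [e1, hmap, Measure.prod_apply_symm hE]
  calc _ ≤ ∫⁻ _, ε ∂(P.map Y) := by
        refine lintegral_mono fun y => ?_
        rw [Measure.map_apply hX (measurable_prodMk_right hE)]
        exact hε y
    _ = ε := by simp

variable {n : ℕ} {σ : ℝ} {M : Ω → Matrix (Fin n) (Fin n) ℂ}

/-- Each entry of a column, or its conjugate, sits at its own position in the upper triangle. -/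
theorem IsWignerMatrix.iIndepFun_col (hM : IsWignerMatrix P σ M) (i : Fin n) :
    iIndepFun (fun k ω => M ω k i) P := by
  set g : Fin n → {p : Fin n × Fin n // p.1 ≤ p.2} :=
    fun k => ⟨(min k i, max k i), min_le_max⟩ with hg
  have hinj : Function.Injective g := by
    intro k l hkl
    simp only [hg, Subtype.mk.injEq, Prod.mk.injEq] at hkl
    obtain ⟨h1, h2⟩ := hkl
    grind
  have h := (hM.indep.precomp hinj).comp
    (fun k x => if k ≤ i then x else (starRingEnd ℂ) x) (fun k => by
      split_ifs
      · exact measurable_id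
      · exact Complex.continuous_conj.measurable)
  convert h using 2 with k
  funext ω
  simp only [Function.comp, hg]
  split_ifs with hk
  · rw [min_eq_left hk, max_eq_right hk]
  · push Not at hk
    rw [min_eq_right hk.le, max_eq_left hk.le]
    exact ((hM.isHermitian ω).apply k i).symm

/-- Cramer's formula `det⁻¹ · adjugate` is measurable even where the determinant vanishes, so
invertibility is not needed. -/
theorem measurable_matrixResolvent {α : Type*} [TopologicalSpace α] [MeasurableSpace α]
    [OpensMeasurableSpace α] {H : α → Matrix (Fin n) (Fin n) ℂ} (hH : Continuous H) (z : ℂ) :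
    Measurable fun u => (fun k l => matrixResolvent (H u) z k l : Fin n → Fin n → ℂ) := by
  refine measurable_pi_lambda _ fun k => measurable_pi_lambda _ fun l => ?_
  have hc : Continuous fun u => H u - z • (1 : Matrix (Fin n) (Fin n) ℂ) := by fun_prop
  have e : ∀ u, matrixResolvent (H u) z k l
      = (H u - z • (1 : Matrix (Fin n) (Fin n) ℂ)).det⁻¹
        * (H u - z • (1 : Matrix (Fin n) (Fin n) ℂ)).adjugate k l := by
    intro u
    rw [matrixResolvent, Matrix.inv_def, Ring.inverse_eq_inv', Matrix.smul_apply, smul_eq_mul]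
  simp_rw [e]
  exact (hc.matrix_det.measurable.inv).mul (hc.matrix_adjugate.matrix_elem k l).measurable

/-- The `i`-th column of a Wigner matrix is independent of the resolvent of its `i`-th minor. -/
theorem IsWignerMatrix.indepFun_col_resolvent (hM : IsWignerMatrix P σ M) (z : ℂ) (i : Fin n) :
    Measurable (fun ω => (fun k l => matrixResolvent (zeroRowCol (normalized (M ω)) i) z k l
      : Fin n → Fin n → ℂ)) ∧
    IndepFun (fun ω => (fun k => M ω k i : Fin n → ℂ))
      (fun ω => (fun k l => matrixResolvent (zeroRowCol (normalized (M ω)) i) z k l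
        : Fin n → Fin n → ℂ)) P := by
  classical
  -- The upper triangular positions split into those in row or column `i`, which determine the
  -- column, and the others, which determine the minor.
  set S : Finset {p : Fin n × Fin n // p.1 ≤ p.2} :=
    Finset.univ.filter fun p => p.1.1 = i ∨ p.1.2 = i with hS
  set T : Finset {p : Fin n × Fin n // p.1 ≤ p.2} :=
    Finset.univ.filter fun p => ¬ (p.1.1 = i ∨ p.1.2 = i) with hT
  have hST : Disjoint S T := Finset.disjoint_filter_filter_not _ _ _
  have hind := hM.indep.indepFun_finset S T hST fun p => hM.measurable_entry _ _
  obtain ⟨F, hFm, hFe⟩ : ∃ F : (S → ℂ) → Fin n → ℂ, Measurable F ∧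
      ∀ ω, F (fun p => M ω p.1.1.1 p.1.1.2) = fun k => M ω k i := by
    refine ⟨fun u k => if h : k ≤ i then u ⟨⟨(k, i), h⟩, by simp [hS]⟩
      else (starRingEnd ℂ) (u ⟨⟨(i, k), (not_le.mp h).le⟩, by simp [hS]⟩),
      measurable_pi_lambda _ fun k => ?_, fun ω => funext fun k => ?_⟩
    · split_ifs
      · exact measurable_pi_apply _
      · exact Complex.continuous_conj.measurable.comp (measurable_pi_apply _)
    · beta_reduce
      split_ifs
      · rfl
      · exact (hM.isHermitian ω).apply k i
  obtain ⟨H, hHc, hHe⟩ : ∃ H : (T → ℂ) → Matrix (Fin n) (Fin n) ℂ, Continuous H ∧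
      ∀ ω, H (fun p => M ω p.1.1.1 p.1.1.2) = zeroRowCol (normalized (M ω)) i := by
    refine ⟨fun u => Matrix.of fun k l => if h : k = i ∨ l = i then 0
      else if h' : k ≤ l then ((1 / √(n : ℝ) : ℝ) : ℂ) * u ⟨⟨(k, l), h'⟩, by simpa [hT] using h⟩
      else ((1 / √(n : ℝ) : ℝ) : ℂ) * (starRingEnd ℂ) (u ⟨⟨(l, k), (not_le.mp h').le⟩,
        by simp only [hT, Finset.mem_filter, Finset.mem_univ, true_and]; tauto⟩),
      continuous_matrix fun k l => ?_, fun ω => ?_⟩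
    · simp only [Matrix.of_apply]
      split_ifs
      · exact continuous_const
      · exact continuous_const.mul (continuous_apply _)
      · exact continuous_const.mul (Complex.continuous_conj.comp (continuous_apply _))
    · ext k l
      simp only [Matrix.of_apply, zeroRowCol_apply, normalized, Matrix.smul_apply, smul_eq_mul]
      split_ifs
      · rfl
      · rfl
      · congr 1
        exact (hM.isHermitian ω).apply k l
  obtain ⟨G, hGm, hGe⟩ : ∃ G : (T → ℂ) → Fin n → Fin n → ℂ, Measurable G ∧
      ∀ u, G u = fun k l => matrixResolvent (H u) z k l :=
    ⟨_, measurable_matrixResolvent hHc z, fun _ => rfl⟩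
  have hcomp := hind.comp hFm hGm
  have e2 : (fun ω => (fun k l => matrixResolvent (zeroRowCol (normalized (M ω)) i) z k l
      : Fin n → Fin n → ℂ)) = fun ω => G fun p => M ω p.1.1.1 p.1.1.2 := by
    funext ω; rw [hGe, hHe]
  have e1 : (fun ω => (fun k => M ω k i : Fin n → ℂ)) = fun ω => F fun p => M ω p.1.1.1 p.1.1.2 := by
    funext ω; rw [hFe]
  rw [e1, e2]
  exact ⟨hGm.comp (measurable_pi_lambda _ fun p => hM.measurable_entry _ _), hcomp⟩

theorem isHermitian_normalized {A : Matrix (Fin n) (Fin n) ℂ} (hA : A.IsHermitian) :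
    (normalized A).IsHermitian := by
  rw [normalized, Matrix.IsHermitian, Matrix.conjTranspose_smul, hA.eq]
  congr 1
  exact Complex.conj_ofReal _

theorem natCast_mul_schurForm_normalized (hn : 0 < n) (A : Matrix (Fin n) (Fin n) ℂ) (z : ℂ)
    (i : Fin n) : (n : ℂ) * schurForm (normalized A) z i
      = ∑ k ∈ Finset.univ.erase i, ∑ l ∈ Finset.univ.erase i,
        star (A k i) * matrixResolvent (zeroRowCol (normalized A) i) z k l * A l i := by
  have hn' : (0 : ℝ) < n := by exact_mod_cast hn
  have hsq : (n : ℂ) * (((1 / √(n : ℝ) : ℝ) : ℂ) * ((1 / √(n : ℝ) : ℝ) : ℂ)) = 1 := by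
    rw [← Complex.ofReal_mul, ← Complex.ofReal_natCast, ← Complex.ofReal_mul, div_mul_div_comm,
      Real.mul_self_sqrt hn'.le]
    rw [one_mul, mul_one_div_cancel hn'.ne', Complex.ofReal_one]
  have hcol : ∀ k, offDiagCol (normalized A) i k
      = if k = i then 0 else ((1 / √(n : ℝ) : ℝ) : ℂ) * A k i := fun k => rfl
  rw [schurForm, Finset.mul_sum, ← Finset.sum_erase (a := i) Finset.univ
    (by simp [hcol])]
  refine Finset.sum_congr rfl fun k hk => ?_
  rw [Finset.mul_sum, ← Finset.sum_erase (a := i) Finset.univ (by simp [hcol])]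
  refine Finset.sum_congr rfl fun l hl => ?_
  rw [hcol, hcol, if_neg (Finset.ne_of_mem_erase hk), if_neg (Finset.ne_of_mem_erase hl),
    star_mul']
  have : star ((1 / √(n : ℝ) : ℝ) : ℂ) = ((1 / √(n : ℝ) : ℝ) : ℂ) := Complex.conj_ofReal _
  rw [this]
  linear_combination (star (A k i) * matrixResolvent (zeroRowCol (normalized A) i) z k l * A l i)
    * hsq

/-- Concentration at a given spectral parameter holds with overwhelming probability. -/
theorem IsWignerMatrix.measure_not_isConcentratedAt_le [IsProbabilityMeasure P] (hM : IsWignerMatrix P σ M) (hn : 0 < n)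
    (z : ℂ) {p : ℕ} (hp : 1 ≤ p) {μ : ℝ} (hμ : 0 ≤ μ)
    (hmom : ∀ i j, HasMomentBound P (fun ω => M ω i j) (4 * p) μ) {lam : ℝ}
    (hlam : 3 * Real.exp 1 * ((4 * p + 1) * (μ ^ 2 + 1)) ≤ lam) :
    P {ω | ¬ IsConcentratedAt (normalized (M ω)) z lam}
      ≤ n * (4 * ENNReal.ofReal (Real.exp (-(2 * p)))) := by
  have hn' : (0 : ℝ) < n := by exact_mod_cast hn
  set K : ℝ := (4 * p + 1) * (μ ^ 2 + 1) with hK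
  set e := ENNReal.ofReal (Real.exp (-(2 * p))) with he
  have hK0 : 0 < K := by positivity
  have hp' : (1 : ℝ) ≤ p := by exact_mod_cast hp
  have hdiag : ∀ i, P {ω | Real.exp 1 * K < ‖M ω i i‖} ≤ e := by
    intro i
    refine measure_lt_norm_le_of_sqMoment_le (hM.measurable_entry i i) hp hK0.le ?_
    -- A diagonal entry is treated as a linear form with one term, so its size is controlled by `μ`
    -- rather than by `σ`.
    have h := sqMoment_linear_le (b := fun k ω => M ω k i) (fun k => hM.measurable_entry k i)
      (hM.iIndepFun_col i) (fun k => hM.mean_zero k i) hp hμ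
      (fun k => (hmom k i).mono (by omega)) (fun _ => 1) {i}
    simp only [Finset.sum_singleton, one_mul, norm_one, one_pow, mul_one] at h
    refine h.trans (ENNReal.ofReal_le_ofReal ?_)
    have h1 : (4 * p + 1) * μ ^ 2 ≤ K := by rw [hK]; gcongr; linarith
    have h2 : 1 ≤ K := one_le_mul_of_one_le_of_one_le (by linarith) (by nlinarith)
    nlinarith
  have hquad : ∀ i, P {ω | 3 * Real.exp 1 * K * √(∑ k ∈ Finset.univ.erase i,
        ∑ l ∈ Finset.univ.erase i,
          ‖matrixResolvent (zeroRowCol (normalized (M ω)) i) z k l‖ ^ 2)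
      < ‖∑ k ∈ Finset.univ.erase i, ∑ l ∈ Finset.univ.erase i, star (M ω k i)
          * matrixResolvent (zeroRowCol (normalized (M ω)) i) z k l * M ω l i
        - ∑ k ∈ Finset.univ.erase i, matrixResolvent (zeroRowCol (normalized (M ω)) i) z k k‖}
      ≤ 3 * e := by
    intro i
    obtain ⟨hmeas, hind⟩ := hM.indepFun_col_resolvent z i
    have hcol : Measurable fun ω => (fun k => M ω k i : Fin n → ℂ) :=
      measurable_pi_lambda _ fun k => hM.measurable_entry k i
    have hE : MeasurableSet {q : (Fin n → ℂ) × (Fin n → Fin n → ℂ) |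
        3 * Real.exp 1 * K * √(∑ k ∈ Finset.univ.erase i, ∑ l ∈ Finset.univ.erase i, ‖q.2 k l‖ ^ 2)
        < ‖∑ k ∈ Finset.univ.erase i, ∑ l ∈ Finset.univ.erase i, star (q.1 k) * q.2 k l * q.1 l
          - ∑ k ∈ Finset.univ.erase i, q.2 k k‖} :=
      (isOpen_lt (by fun_prop) (by fun_prop)).measurableSet
    -- Conditioning on the minor turns its resolvent into a fixed matrix `A`.
    refine IndepFun.measure_prodMk_mem_le hcol hmeas hind hE fun A => ?_
    refine measure_quadratic_form_le (b := fun k ω => M ω k i)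
      (fun k => hM.measurable_entry k i) (hM.iIndepFun_col i) (fun k => hM.mean_zero k i) hp hμ
      (fun k => hmom k i) (Finset.univ.erase i) (fun k hk => ?_) A
    rcases lt_or_gt_of_ne (Finset.ne_of_mem_erase hk) with h | h
    · exact hM.variance_offDiag k i h
    · rw [← hM.variance_offDiag i k h]
      refine integral_congr_ae (Eventually.of_forall fun ω => ?_)
      simp only
      rw [← (hM.isHermitian ω).apply k i, norm_star]
  have hsub : {ω | ¬ IsConcentratedAt (normalized (M ω)) z lam} ⊆ ⋃ i ∈ Finset.univ (α := Fin n),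
      ({ω | Real.exp 1 * K < ‖M ω i i‖} ∪ {ω | 3 * Real.exp 1 * K * √(∑ k ∈ Finset.univ.erase i,
        ∑ l ∈ Finset.univ.erase i,
          ‖matrixResolvent (zeroRowCol (normalized (M ω)) i) z k l‖ ^ 2)
      < ‖∑ k ∈ Finset.univ.erase i, ∑ l ∈ Finset.univ.erase i, star (M ω k i)
          * matrixResolvent (zeroRowCol (normalized (M ω)) i) z k l * M ω l i
        - ∑ k ∈ Finset.univ.erase i,
          matrixResolvent (zeroRowCol (normalized (M ω)) i) z k k‖}) := by
    intro ω hω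
    by_contra hcon
    refine hω fun i => ?_
    simp only [Set.mem_iUnion, Finset.mem_univ, exists_prop, true_and, not_exists, Set.mem_union,
      Set.mem_ofPred_eq, not_or, not_lt] at hcon
    obtain ⟨h1, h2⟩ := hcon i
    constructor
    · have : ‖normalized (M ω) i i‖ = ‖M ω i i‖ / √n := by
        rw [normalized, Matrix.smul_apply, smul_eq_mul, norm_mul, Complex.norm_real,
          Real.norm_of_nonneg (by positivity)]
        ring
      rw [this]
      gcongr
      refine h1.trans (le_trans ?_ hlam)
      have := Real.exp_pos 1
      nlinarith [mul_pos this hK0]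
    · rw [natCast_mul_schurForm_normalized hn]
      refine h2.trans (mul_le_mul hlam (Real.sqrt_le_sqrt ?_) (Real.sqrt_nonneg _)
        (le_trans (by positivity) hlam))
      refine (Finset.sum_le_sum_of_subset_of_nonneg (Finset.erase_subset _ _)
        fun _ _ _ => by positivity).trans (Finset.sum_le_sum fun k _ => ?_)
      exact Finset.sum_le_sum_of_subset_of_nonneg (Finset.erase_subset _ _)
        fun _ _ _ => by positivity
  calc _ ≤ _ := measure_mono hsub
    _ ≤ ∑ i : Fin n, (e + 3 * e) := (measure_biUnion_finset_le _ _).trans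
        (Finset.sum_le_sum fun i _ => (measure_union_le _ _).trans (add_le_add (hdiag i) (hquad i)))
    _ = _ := by
        rw [Finset.sum_const, Finset.card_univ, Fintype.card_fin, nsmul_eq_mul]
        ring

end Concentration

/-! ### Choice of parameters and the local law. -/

section LocalLaw

/-- The exponential decay condition bounds the moments of the entries, uniformly in the matrix. -/
theorem exists_hasMomentBound_of_hasExpDecay (C C' : ℝ) :
    ∃ (D : ℕ) (K : ℝ), 0 ≤ K ∧ ∀ {Ω : Type*} [MeasurableSpace Ω] (P : Measure Ω)
      [IsProbabilityMeasure P] {n : ℕ} (M : Ω → Matrix (Fin n) (Fin n) ℂ),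
      (∀ i j, Measurable fun ω => M ω i j) → HasExpDecay P C C' M →
      ∀ q i j, HasMomentBound P (fun ω => M ω i j) q ((K * q) ^ D) := by
  -- The exponent is rounded up to a positive integer, and the threshold is at least `1` so that
  -- `t^C ≤ t^D` beyond it.
  refine ⟨max 1 ⌈C⌉₊, _, ?_, fun P _ n M hmeas hdec q i j => hasMomentBound_of_tail (hmeas i j)
    (le_max_left _ _) (T₀ := max C' 1) (by positivity) (fun t ht => ?_) q⟩
  · have : Real.exp (-1 / 2) < 1 := Real.exp_lt_one_iff.mpr (by norm_num)
    have : 0 < 1 - Real.exp (-1 / 2) := by linarith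
    positivity
  · refine (measureReal_mono ?_).trans (hdec i j t ((le_max_left _ _).trans ht))
    intro ω hω
    refine le_trans ?_ (Set.mem_ofPred_eq.mp hω)
    rw [← Real.rpow_natCast]
    refine Real.rpow_le_rpow_of_exponent_le ((le_max_right _ _).trans ht) ?_
    exact (Nat.le_ceil C).trans (by exact_mod_cast le_max_right _ _)

theorem tendsto_localLaw_error (L : ℝ) :
    Tendsto (fun n : ℕ => 2 * √(L * ((n : ℝ) ^ (-(1 / 4) : ℝ)
      + 2 * Real.log n ^ (-(3 / 8) : ℝ)) + 1 / Real.log n) + 80 / (n : ℝ) ^ 2) atTop (𝓝 0) := by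
  have hn : Tendsto (fun n : ℕ => (n : ℝ)) atTop atTop := tendsto_natCast_atTop_atTop
  have hlog : Tendsto (fun n : ℕ => Real.log n) atTop atTop := Real.tendsto_log_atTop.comp hn
  have h1 := (tendsto_rpow_neg_atTop (y := 1 / 4) (by norm_num)).comp hn
  have h2 := (tendsto_rpow_neg_atTop (y := 3 / 8) (by norm_num)).comp hlog
  have h3 : Tendsto (fun n : ℕ => 1 / Real.log n) atTop (𝓝 0) := hlog.const_div_atTop 1
  have h4 : Tendsto (fun n : ℕ => 80 / (n : ℝ) ^ 2) atTop (𝓝 0) :=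
    ((tendsto_pow_atTop (by norm_num)).comp hn).const_div_atTop 80
  have h := (((((h1.add (h2.const_mul 2)).const_mul L).add h3).sqrt).const_mul 2).add h4
  simpa using h

/-- The local semicircle law at logarithmic scales, with explicit parameters. -/
theorem IsWignerMatrix.measure_local_law_le {Ω : Type*} [MeasurableSpace Ω] {P : Measure Ω}
    [IsProbabilityMeasure P] {n : ℕ} {σ : ℝ} {M : Ω → Matrix (Fin n) (Fin n) ℂ}
    (hM : IsWignerMatrix P σ M) (hn : 0 < n) {p : ℕ} (hp : 1 ≤ p) {μ lam : ℝ} (hμ : 0 ≤ μ)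
    (hmom : ∀ i j, HasMomentBound P (fun ω => M ω i j) (4 * p) μ)
    (hlam : 3 * Real.exp 1 * ((4 * p + 1) * (μ ^ 2 + 1)) ≤ lam) {E η T δ r : ℝ}
    (hη : 0 < η) (hT : 1 ≤ T) (hTn : T ≤ n * η)
    (hδ : lam * (1 / √n + 2 / √T) + 1 / T ≤ δ) (hr : 0 < r) (hδr : 4 * δ ≤ r ^ 2)
    (hr20 : r ≤ 1 / 20) (hrn : 80 / (n : ℝ) ^ 2 ≤ r) :
    P.real {ω | ¬ (
      ‖stieltjes (normalized (M ω)) (E + η * Complex.I) - stieltjesSC (E + η * Complex.I)‖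
        ≤ 12 * r ∧
      ∀ i : Fin n, ‖matrixResolvent (normalized (M ω)) (E + η * Complex.I) i i
        - stieltjesSC (E + η * Complex.I)‖ ≤ 12 * r)}
      ≤ 8 * (n : ℝ) ^ 5 * Real.exp (-(2 * p)) := by
  have hlam0 : 0 ≤ lam := le_trans (by positivity) hlam
  have hn1 : (1 : ℝ) ≤ n := by exact_mod_cast hn
  set z : ℕ → ℂ := fun k => E + ((η + 4 * (1 - k / (n : ℝ) ^ 4) : ℝ) : ℂ) * Complex.I with hz
  have hsub : {ω | ¬ (
      ‖stieltjes (normalized (M ω)) (E + η * Complex.I) - stieltjesSC (E + η * Complex.I)‖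
        ≤ 12 * r ∧
      ∀ i : Fin n, ‖matrixResolvent (normalized (M ω)) (E + η * Complex.I) i i
        - stieltjesSC (E + η * Complex.I)‖ ≤ 12 * r)}
      ⊆ ⋃ k ∈ Finset.range (n ^ 4 + 1), {ω | ¬ IsConcentratedAt (normalized (M ω)) (z k) lam} := by
    intro ω hω
    by_contra hcon
    simp only [Set.mem_iUnion, exists_prop, not_exists, not_and, Set.mem_ofPred_eq,
      not_not] at hcon
    exact hω (local_law_of_isConcentratedAt hn (isHermitian_normalized (hM.isHermitian ω)) hη hT
      hTn hlam0 hδ hr hδr hr20 hrn hcon)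
  have hP : P {ω | ¬ (
      ‖stieltjes (normalized (M ω)) (E + η * Complex.I) - stieltjesSC (E + η * Complex.I)‖
        ≤ 12 * r ∧
      ∀ i : Fin n, ‖matrixResolvent (normalized (M ω)) (E + η * Complex.I) i i
        - stieltjesSC (E + η * Complex.I)‖ ≤ 12 * r)}
      ≤ ENNReal.ofReal (((n : ℝ) ^ 4 + 1) * (n * (4 * Real.exp (-(2 * p))))) := by
    refine (measure_mono hsub).trans ((measure_biUnion_finset_le _ _).trans
      ((Finset.sum_le_sum fun k _ =>
        hM.measure_not_isConcentratedAt_le hn (z k) hp hμ hmom hlam).trans_eq ?_))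
    rw [Finset.sum_const, Finset.card_range, nsmul_eq_mul, ENNReal.ofReal_mul (by positivity),
      ENNReal.ofReal_mul (by positivity), ENNReal.ofReal_mul (by positivity),
      ENNReal.ofReal_natCast]
    congr 1
    · rw [← ENNReal.ofReal_natCast]; push_cast; rfl
    · simp
  refine (ENNReal.toReal_le_of_le_ofReal (by positivity) hP).trans ?_
  have h1 : (n : ℝ) ^ 4 + 1 ≤ 2 * (n : ℝ) ^ 4 := by nlinarith [one_le_pow₀ hn1 (n := 4)]
  calc _ ≤ 2 * (n : ℝ) ^ 4 * (n * (4 * Real.exp (-(2 * p)))) := by gcongr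
    _ = _ := by ring

/-- This makes the tolerance uniform in `T`: `T ≤ n²` controls `T^(1/8) n^(-1/2)`, and `T ≥ x`
controls `T^(1/8 - 1/2)`. It is used with `x = log n`. -/
theorem localLaw_tolerance_le {n : ℕ} {T x L lam : ℝ} (hn : 0 < n) (hx : 1 ≤ x) (hxT : x ≤ T)
    (hTn : T ≤ (n : ℝ) ^ 2) (hL : 0 ≤ L) (hlam : lam ≤ L * T ^ (1 / 8 : ℝ)) :
    lam * (1 / √n + 2 / √T) + 1 / T
      ≤ L * ((n : ℝ) ^ (-(1 / 4) : ℝ) + 2 * x ^ (-(3 / 8) : ℝ)) + 1 / x := by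
  have hn' : (0 : ℝ) < n := by exact_mod_cast hn
  have hx0 : 0 < x := by linarith
  have hT0 : 0 < T := by linarith
  have h1 : T ^ (1 / 8 : ℝ) * (1 / √n) ≤ (n : ℝ) ^ (-(1 / 4) : ℝ) := by
    calc T ^ (1 / 8 : ℝ) * (1 / √n) ≤ ((n : ℝ) ^ 2) ^ (1 / 8 : ℝ) * (1 / √n) := by gcongr
      _ = (n : ℝ) ^ (1 / 4 : ℝ) * (n : ℝ) ^ (-(1 / 2) : ℝ) := by
          rw [← Real.rpow_natCast, ← Real.rpow_mul hn'.le, Real.sqrt_eq_rpow,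
            Real.rpow_neg hn'.le (1 / 2)]
          norm_num
      _ = _ := by rw [← Real.rpow_add hn']; norm_num
  have h2 : T ^ (1 / 8 : ℝ) * (2 / √T) ≤ 2 * x ^ (-(3 / 8) : ℝ) := by
    calc T ^ (1 / 8 : ℝ) * (2 / √T) = 2 * (T ^ (1 / 8 : ℝ) * T ^ (-(1 / 2) : ℝ)) := by
          rw [Real.sqrt_eq_rpow, Real.rpow_neg hT0.le (1 / 2)]; ring
      _ = 2 * T ^ (-(3 / 8) : ℝ) := by rw [← Real.rpow_add hT0]; norm_num
      _ ≤ _ := by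
          have := Real.rpow_le_rpow_of_nonpos hx0 hxT (z := -(3 / 8)) (by norm_num)
          linarith
  have h3 : 1 / T ≤ 1 / x := one_div_le_one_div_of_le hx0 hxT
  calc lam * (1 / √n + 2 / √T) + 1 / T
      ≤ L * T ^ (1 / 8 : ℝ) * (1 / √n + 2 / √T) + 1 / x := by gcongr
    _ = L * (T ^ (1 / 8 : ℝ) * (1 / √n) + T ^ (1 / 8 : ℝ) * (2 / √T)) + 1 / x := by ring
    _ ≤ _ := by gcongr

end LocalLaw

theorem corollaryA5 (C C' : ℝ) (hC : 0 < C) (hC' : 0 < C') :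
    ∃ c : ℝ, 0 < c ∧ ∀ K₁ K₂ : ℝ, ∃ (A : ℝ) (B : ℕ) (ε : ℕ → ℝ), Tendsto ε atTop (𝓝 0) ∧
      ∀ (n : ℕ), 0 < n →
      ∀ (Ω : Type*) [MeasurableSpace Ω] (P : Measure Ω) [IsProbabilityMeasure P]
        (σ : ℝ) (M : Ω → Matrix (Fin n) (Fin n) ℂ),
        IsWignerMatrix P σ M → HasExpDecay P C C' M →
      ∀ E η : ℝ, |E| ≤ K₁ → 0 < η → η ≤ K₂ * (n : ℝ) ^ 100 →
        P.real {ω | ¬ (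
            ‖stieltjes (normalized (M ω)) (E + η * Complex.I)
              - stieltjesSC (E + η * Complex.I)‖ ≤ ε n ∧
            ∀ i : Fin n, ‖matrixResolvent (normalized (M ω)) (E + η * Complex.I) i i
              - stieltjesSC (E + η * Complex.I)‖ ≤ ε n)}
          ≤ A * (n : ℝ) ^ B * Real.exp (-c * ((n : ℝ) * η) ^ c) := by
  obtain ⟨D, K, hK0, hmomAll⟩ := exists_hasMomentBound_of_hasExpDecay C C'
  -- The tolerance of order `p μ²` with `μ` of order `p^D` is of order `p^d`; for `p` of order `T^c`
  -- this is `T^(1/8)`.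
  set d : ℕ := 2 * D + 1 with hd
  set c : ℝ := 1 / (8 * d) with hc
  have hd1 : (1 : ℝ) ≤ d := by exact_mod_cast (by omega : 1 ≤ d)
  have hc0 : 0 < c := by positivity
  have hc1 : c ≤ 1 := by rw [hc, div_le_one (by positivity)]; linarith
  set L₀ : ℝ := 3 * Real.exp 1 * (5 * ((4 * K) ^ (2 * D) + 1)) with hL₀
  have hL₀0 : 0 ≤ L₀ := by positivity
  set L : ℝ := L₀ * 2 ^ d with hL
  have hL0 : 0 ≤ L := by positivity
  set δ : ℕ → ℝ := fun n => L * ((n : ℝ) ^ (-(1 / 4) : ℝ)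
      + 2 * Real.log n ^ (-(3 / 8) : ℝ)) + 1 / Real.log n with hδ
  -- The first summand ensures `4δ ≤ r²`, the second covers the grid step.
  set r : ℕ → ℝ := fun n => 2 * √(δ n) + 80 / (n : ℝ) ^ 2 with hr
  have hrlim : Tendsto r atTop (𝓝 0) := tendsto_localLaw_error L
  have hr0 : ∀ n, 0 ≤ r n := fun n => by positivity
  have hlog : Tendsto (fun n : ℕ => Real.log n) atTop atTop :=
    Real.tendsto_log_atTop.comp tendsto_natCast_atTop_atTop
  obtain ⟨n₀, hn₀⟩ := eventually_atTop.mp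
    ((hrlim.eventually_le_const (by norm_num : (0 : ℝ) < 1 / 20)).and
      (hlog.eventually_ge_atTop 1))
  refine ⟨c, hc0, fun K₁ K₂ => ⟨8 + Real.exp (1 + (n₀ : ℝ) ^ 2), 5,
    fun n => 12 * r n + 2 / n, ?_, ?_⟩⟩
  · have h2 : Tendsto (fun n : ℕ => 2 / (n : ℝ)) atTop (𝓝 0) :=
      tendsto_natCast_atTop_atTop.const_div_atTop 2
    simpa using (hrlim.const_mul 12).add h2
  intro n hn Ω _ P _ σ M hM hdec E η _ hη _
  have hn' : (0 : ℝ) < n := by exact_mod_cast hn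
  have hn1 : (1 : ℝ) ≤ n := by exact_mod_cast hn
  set T : ℝ := n * η with hT
  have hT0 : 0 < T := by positivity
  have hA0 : 0 < Real.exp (1 + (n₀ : ℝ) ^ 2) := Real.exp_pos _
  have hn5 : 1 ≤ (n : ℝ) ^ 5 := one_le_pow₀ hn1
  have hpos : 0 ≤ T ^ c := by positivity
  have hTc : T ^ c ≤ 1 + T := by
    rcases le_total T 1 with h | h
    · exact (Real.rpow_le_one hT0.le h hc0.le).trans (by linarith)
    · exact (Real.rpow_le_self_of_one_le h hc1).trans (by linarith)
  have hcT : c * T ^ c ≤ T ^ c := mul_le_of_le_one_left hpos hc1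
  rcases le_or_gt (n : ℝ) η with hηn | hηn
  · -- far from the real axis both sides are small
    have hzim : 0 < ((E : ℂ) + η * Complex.I).im := by simpa using hη
    have him : ((E : ℂ) + η * Complex.I).im = η := by simp
    have hinv : 1 / η ≤ 1 / n := one_div_le_one_div_of_le hn' hηn
    have hm := norm_stieltjesSC_le hzim
    rw [him] at hm
    have h2n : (2 : ℝ) / n = 1 / n + 1 / n := by ring
    have hempty : {ω | ¬ (
            ‖stieltjes (normalized (M ω)) (E + η * Complex.I)
              - stieltjesSC (E + η * Complex.I)‖ ≤ 12 * r n + 2 / n ∧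
            ∀ i : Fin n, ‖matrixResolvent (normalized (M ω)) (E + η * Complex.I) i i
              - stieltjesSC (E + η * Complex.I)‖ ≤ 12 * r n + 2 / n)} = ∅ := by
      rw [Set.eq_empty_iff_forall_notMem]
      intro ω hω
      have hW := isHermitian_normalized (hM.isHermitian ω)
      refine hω ⟨?_, fun i => ?_⟩
      · have h1 := norm_stieltjes_le hn hW hzim
        rw [him] at h1
        exact (norm_sub_le _ _).trans (by linarith [hr0 n])
      · have h1 := norm_matrixResolvent_diag_le hW hzim i
        rw [him] at h1
        exact (norm_sub_le _ _).trans (by linarith [hr0 n])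
    rw [hempty, measureReal_empty]
    positivity
  have hTn2 : T ≤ (n : ℝ) ^ 2 := by rw [hT]; nlinarith
  have htriv : 1 ≤ (8 + Real.exp (1 + (n₀ : ℝ) ^ 2)) * (n : ℝ) ^ 5 * Real.exp (-c * T ^ c) →
      P.real {ω | ¬ (
            ‖stieltjes (normalized (M ω)) (E + η * Complex.I)
              - stieltjesSC (E + η * Complex.I)‖ ≤ 12 * r n + 2 / n ∧
            ∀ i : Fin n, ‖matrixResolvent (normalized (M ω)) (E + η * Complex.I) i i
              - stieltjesSC (E + η * Complex.I)‖ ≤ 12 * r n + 2 / n)}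
      ≤ (8 + Real.exp (1 + (n₀ : ℝ) ^ 2)) * (n : ℝ) ^ 5 * Real.exp (-c * T ^ c) :=
    fun h => measureReal_le_one.trans h
  -- For `n < n₀` the prefactor `exp(1 + n₀²)` makes the bound at least one, since `c T^c ≤ 1 + T ≤
  -- 1 + n₀²`.
  rcases lt_or_ge n n₀ with hnn | hnn
  · refine htriv ?_
    have h1 : (n : ℝ) ≤ n₀ := by exact_mod_cast hnn.le
    have h2 : -(1 + (n₀ : ℝ) ^ 2) ≤ -c * T ^ c := by nlinarith
    calc (1 : ℝ) = Real.exp (1 + (n₀ : ℝ) ^ 2) * Real.exp (-(1 + (n₀ : ℝ) ^ 2)) := by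
          rw [← Real.exp_add, add_neg_cancel, Real.exp_zero]
      _ ≤ (8 + Real.exp (1 + (n₀ : ℝ) ^ 2)) * (n : ℝ) ^ 5 * Real.exp (-c * T ^ c) := by
          gcongr
          nlinarith
  obtain ⟨hr20, hlog1⟩ := hn₀ n hnn
  -- If `T^c < log n`, the factor `n⁵` outweighs the exponential; otherwise `T ≥ T^c ≥ log n ≥ 1`.
  rcases lt_or_ge (T ^ c) (Real.log n) with hTl | hTl
  · refine htriv ?_
    have h2 : -Real.log n ≤ -c * T ^ c := by nlinarith
    calc (1 : ℝ) = n * Real.exp (-Real.log n) := by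
          rw [Real.exp_neg, Real.exp_log hn', mul_inv_cancel₀ hn'.ne']
      _ ≤ (8 + Real.exp (1 + (n₀ : ℝ) ^ 2)) * (n : ℝ) ^ 5 * Real.exp (-c * T ^ c) := by
          gcongr
          have : (n : ℝ) ≤ (n : ℝ) ^ 5 := le_self_pow₀ hn1 (by norm_num)
          nlinarith
  have hT1 : 1 ≤ T := by
    by_contra hcon
    push Not at hcon
    have := Real.rpow_lt_one hT0.le hcon hc0
    linarith
  have hlogT : Real.log n ≤ T := hTl.trans (Real.rpow_le_self_of_one_le hT1 hc1)
  set p : ℕ := ⌈T ^ c⌉₊ with hp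
  have hpT : T ^ c ≤ p := Nat.le_ceil _
  have hp1' : (1 : ℝ) ≤ p := by linarith
  have hp1 : 1 ≤ p := by exact_mod_cast hp1'
  have hp2 : (p : ℝ) ≤ 2 * T ^ c := by
    have := (Nat.ceil_lt_add_one hpos).le
    linarith
  have hpd : (p : ℝ) ^ d ≤ 2 ^ d * T ^ (1 / 8 : ℝ) := by
    calc (p : ℝ) ^ d ≤ (2 * T ^ c) ^ d := by gcongr
      _ = 2 ^ d * T ^ (1 / 8 : ℝ) := by
          rw [mul_pow, ← Real.rpow_natCast (T ^ c), ← Real.rpow_mul hT0.le, hc]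
          congr 2
          field_simp
  set μ : ℝ := (K * (4 * p : ℕ)) ^ D with hμ
  have hμ0 : 0 ≤ μ := by positivity
  have hlam : 3 * Real.exp 1 * ((4 * p + 1) * (μ ^ 2 + 1)) ≤ L₀ * (p : ℝ) ^ d := by
    have h1 : μ ^ 2 + 1 ≤ ((4 * K) ^ (2 * D) + 1) * (p : ℝ) ^ (2 * D) := by
      have e : μ ^ 2 = (4 * K) ^ (2 * D) * (p : ℝ) ^ (2 * D) := by
        rw [hμ, ← pow_mul, ← mul_pow, mul_comm D 2]; push_cast; ring
      have := one_le_pow₀ hp1' (n := 2 * D)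
      rw [e]; linarith
    have h2 : (4 * (p : ℝ) + 1) ≤ 5 * p := by linarith
    calc 3 * Real.exp 1 * ((4 * p + 1) * (μ ^ 2 + 1))
        ≤ 3 * Real.exp 1 * (5 * p * (((4 * K) ^ (2 * D) + 1) * (p : ℝ) ^ (2 * D))) := by gcongr
      _ = L₀ * (p : ℝ) ^ d := by rw [hL₀, hd, pow_succ]; ring
  have hδn : L₀ * (p : ℝ) ^ d * (1 / √n + 2 / √T) + 1 / T ≤ δ n :=
    localLaw_tolerance_le hn hlog1 hlogT hTn2 hL0 
      ((mul_le_mul_of_nonneg_left hpd hL₀0).trans_eq (by rw [hL]; ring))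
  have hδ0 : 0 ≤ δ n := by
    have : 0 < Real.log n := by linarith
    simp only [hδ]; positivity
  have hsq : 4 * δ n ≤ r n ^ 2 := by
    have h1 : 2 * √(δ n) ≤ r n := by
      have : 0 ≤ 80 / (n : ℝ) ^ 2 := by positivity
      simp only [hr]; linarith
    calc 4 * δ n = (2 * √(δ n)) ^ 2 := by rw [mul_pow, Real.sq_sqrt hδ0]; norm_num
      _ ≤ r n ^ 2 := by gcongr
  have hrn : 80 / (n : ℝ) ^ 2 ≤ r n := by
    simp only [hr]; linarith [Real.sqrt_nonneg (δ n)]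
  have hrpos : 0 < r n := lt_of_lt_of_le (by positivity) hrn
  have hmain := hM.measure_local_law_le hn hp1 hμ0
    (fun i j => hmomAll P M hM.measurable_entry hdec (4 * p) i j) hlam (E := E) hη hT1 hT.le hδn
    hrpos hsq hr20 hrn
  have h2n : (0 : ℝ) ≤ 2 / n := by positivity
  have hle : 12 * r n ≤ 12 * r n + 2 / n := le_add_of_nonneg_right h2n
  refine (measureReal_mono ?_).trans (hmain.trans ?_)
  · intro ω hω
    rw [Set.mem_ofPred_eq] at hω ⊢
    exact fun hcon => hω ⟨hcon.1.trans hle, fun i => (hcon.2 i).trans hle⟩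
  · have h2 : -(2 * (p : ℝ)) ≤ -c * T ^ c := by rw [neg_mul]; linarith
    calc 8 * (n : ℝ) ^ 5 * Real.exp (-(2 * p)) ≤ 8 * (n : ℝ) ^ 5 * Real.exp (-c * T ^ c) := by
          gcongr
      _ ≤ _ := by gcongr; linarith
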